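/- Let $A:\mathbb R^2\to\mathbb C$ be continuous with $\theta:=\limsup_{p\to\infty}|A(p)|/|p|^2<1$, and let $H_0$ be the self-adjoint operator in $L^2(\mathbb R^2)\otimes\mathbb C^2$ that acts in the Fourier picture (momentum variable $p$, on its maximal domain) as multiplication by the matrix $$\widehat H_0(p)=\begin{pmatrix}|p|^2&A(p)\\ \overline{A(p)}&|p|^2\end{pmatrix}.$$ Let $m$ be a finite positive Borel measure on $\mathbb R^2$ and let $h:\mathbb R^2\to\mathbb R$ be a bounded Borel function such that, for some constants $a\in(0,1)$ and $b>0$, $$\int(1+|h|^2)|f|^2\,dm\le a\int|\nabla f|^2\,dx+b\int|f|^2\,dx\qquad\text{for all } f\in\mathcal S(\mathbb R^2).$$ Let $J_2:H^1(\mathbb R^2)\otimes\mathbb C^2\to L^2(\mathbb R^2,m)\otimes\mathbb C^2$ be the bounded linear extension of the identity on Schwartz spinors, let $q_0$ be the quadratic form of $H_0$ (with form domain $H^1(\mathbb R^2)\otimes\mathbb C^2$), and put $$q(f,g)=q_0(f,g)+\int_{\mathbb R^2}h\,\langle J_2f,J_2g\rangle_{\mathbb C^2}\,dm,\qquad f,g\in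 H^1(\mathbb R^2)\otimes\mathbb C^2.$$ (i) If $\theta+a/2<1$, then $q$ is semibounded below and closed. (ii) Whenever $q$ is semibounded below and closed, it is the form of a (unique) self-adjoint operator $H=H_0+\nu$, $\nu=hm$, and the essential spectra of $H_0$ and $H$ coincide. Here the essential spectrum of a self-adjoint operator $T$ is the set of all $z\in\mathbb C$ for which $T-z$ is not Fredholm, i.e. the spectrum without the isolated eigenvalues of finite multiplicity. -/

import Mathlib

open MeasureTheory Filter Topology
open scoped FourierTransform SchwartzMap ENNReal ComplexConjugate

noncomputable section

namespace SpinOrbit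

/-! ### Unbounded operators and quadratic forms in a complex Hilbert space -/

section Abstract

variable {V : Type*} [NormedAddCommGroup V] [InnerProductSpace ℂ V]

/-- `T - z` on the domain of `T`. -/
def shift (T : V →ₗ.[ℂ] V) (z : ℂ) : T.domain →ₗ[ℂ] V :=
  T.toFun - z • T.domain.subtype

/-- The unbounded operator `T - z` is Fredholm: finite-dimensional kernel, closed range of finite
codimension. -/
structure IsFredholmAt (T : V →ₗ.[ℂ] V) (z : ℂ) : Prop where
  finite_ker : FiniteDimensional ℂ (LinearMap.ker (shift T z))
  closed_range : IsClosed (LinearMap.range (shift T z) : Set V)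
  finite_coker : FiniteDimensional ℂ (V ⧸ LinearMap.range (shift T z))

/-- The essential spectrum of a closed operator: all `z` for which `T - z` is not Fredholm.
For a self-adjoint operator this is the spectrum without the isolated eigenvalues of finite
multiplicity. -/
def essentialSpectrum (T : V →ₗ.[ℂ] V) : Set ℂ :=
  {z | ¬ IsFredholmAt T z}

/-- A form `q` (antilinear in the first argument) with domain `D` is semibounded below. -/
def FormSemibounded (D : Submodule ℂ V) (q : D → D → ℂ) : Prop :=
  ∃ c : ℝ, ∀ u : D, c * ‖(u : V)‖ ^ 2 ≤ (q u u).re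

/-- A form `q` with domain `D` is closed: whenever `u n ∈ D` converges in the Hilbert space to `x`
and `q (u n - u k) (u n - u k) → 0`, then `x ∈ D` and `q (u n - x) (u n - x) → 0`. -/
def FormClosed (D : Submodule ℂ V) (q : D → D → ℂ) : Prop :=
  ∀ (u : ℕ → D) (x : V), Tendsto (fun n => (u n : V)) atTop (𝓝 x) →
    Tendsto (fun k : ℕ × ℕ => q (u k.1 - u k.2) (u k.1 - u k.2)) atTop (𝓝 0) →
    ∃ hx : x ∈ D, Tendsto (fun n => q (u n - ⟨x, hx⟩) (u n - ⟨x, hx⟩)) atTop (𝓝 0)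

/-- `T` is the operator associated with the form `q` on `D`: `u` is in the domain of `T` and
`T u = w` exactly when `u ∈ D` and `q v u = ⟪v, w⟫` for all `v ∈ D`. This determines `T`. -/
def IsFormOperator (D : Submodule ℂ V) (q : D → D → ℂ) (T : V →ₗ.[ℂ] V) : Prop :=
  ∀ u w : V, (u, w) ∈ T.graph ↔ ∃ hu : u ∈ D, ∀ v : D, q v ⟨u, hu⟩ = inner ℂ (v : V) w

end Abstract

/-! ### Spinors on the plane -/

/-- The plane `ℝ²`. -/
abbrev Plane := EuclideanSpace ℝ (Fin 2)

/-- The space `ℂ²` of spinor values. -/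
abbrev Spin := EuclideanSpace ℂ (Fin 2)

/-- `L²(ℝ², μ) ⊗ ℂ²`, as the space of `ℂ²`-valued square-integrable functions. -/
abbrev SpinL2 (μ : Measure Plane) := Lp Spin 2 μ

/-- The Hilbert space `L²(ℝ²) ⊗ ℂ²`. -/
abbrev Spinors := SpinL2 (volume : Measure Plane)

/-! ### The unperturbed Hamiltonian -/

/-- The matrix `Ĥ₀(p)`, with `p² = |p|²`. -/
def symbol (A : Plane → ℂ) (p : Plane) : Matrix (Fin 2) (Fin 2) ℂ :=
  !![((‖p‖ ^ 2 : ℝ) : ℂ), A p; conj (A p), ((‖p‖ ^ 2 : ℝ) : ℂ)]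

/-- Mathlib's Fourier transform `𝓕 u ξ = ∫ e^(-2πi⟨x, ξ⟩) u(x) dx` is a function of the frequency
`ξ`, the momentum being `p = 2πξ`. This is the function `ξ ↦ Ĥ₀(2πξ) (𝓕 u)(ξ)`. -/
def symbolFourier (A : Plane → ℂ) (u : Spinors) (ξ : Plane) : Spin :=
  Matrix.toEuclideanLin (symbol A ((2 * Real.pi) • ξ)) ((𝓕 u : Spinors) ξ)

lemma symbolFourier_add (A : Plane → ℂ) (u v : Spinors) :
    symbolFourier A (u + v) =ᵐ[volume] symbolFourier A u + symbolFourier A v := by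
  have h : (𝓕 (u + v) : Spinors) = 𝓕 u + 𝓕 v := FourierTransform.fourier_add u v
  filter_upwards [Lp.coeFn_add (𝓕 u : Spinors) (𝓕 v)] with ξ hξ
  simp only [symbolFourier, h, hξ, Pi.add_apply, map_add]

lemma symbolFourier_smul (A : Plane → ℂ) (c : ℂ) (u : Spinors) :
    symbolFourier A (c • u) =ᵐ[volume] c • symbolFourier A u := by
  have h : (𝓕 (c • u) : Spinors) = c • 𝓕 u := FourierTransform.fourier_smul c u
  filter_upwards [Lp.coeFn_smul c (𝓕 u : Spinors)] with ξ hξ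
  simp [symbolFourier, h, hξ]

/-- The maximal domain of the multiplication by `Ĥ₀` in the Fourier picture. -/
def domH0 (A : Plane → ℂ) : Submodule ℂ Spinors where
  carrier := {u | MemLp (symbolFourier A u) 2 volume}
  add_mem' := fun {u v} hu hv => (hu.add hv).ae_eq (symbolFourier_add A u v).symm
  zero_mem' := by
    have h := symbolFourier_smul A 0 0
    rw [zero_smul, zero_smul] at h
    exact (MemLp.zero : MemLp (0 : Plane → Spin) 2 volume).ae_eq h.symm
  smul_mem' := fun c u hu => (hu.const_smul c).ae_eq (symbolFourier_smul A c u).symm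

lemma domH0_memLp {A : Plane → ℂ} (u : domH0 A) : MemLp (symbolFourier A u) 2 volume := u.2

/-- The Hamiltonian `H₀`: multiplication by `Ĥ₀` in the Fourier picture, on its maximal domain. -/
def H0 (A : Plane → ℂ) : Spinors →ₗ.[ℂ] Spinors where
  domain := domH0 A
  toFun :=
    { toFun := fun u => 𝓕⁻ ((domH0_memLp u).toLp _ : Spinors)
      map_add' := fun u v => by
        rw [← FourierTransform.fourierInv_add, ← MemLp.toLp_add]
        refine congrArg _ ?_
        exact MemLp.toLp_congr _ _ (symbolFourier_add A u v)
      map_smul' := fun c u => by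
        rw [RingHom.id_apply, ← FourierTransform.fourierInv_smul, ← MemLp.toLp_const_smul]
        refine congrArg _ ?_
        exact MemLp.toLp_congr _ _ (symbolFourier_smul A c u) }

/-! ### The Sobolev space `H¹(ℝ²) ⊗ ℂ²` -/

/-- The function `ξ ↦ (1 + |2πξ|²)^(1/2) (𝓕 u)(ξ)`. -/
def weightedFourier (u : Spinors) (ξ : Plane) : Spin :=
  Real.sqrt (1 + (2 * Real.pi * ‖ξ‖) ^ 2) • (𝓕 u : Spinors) ξ

lemma weightedFourier_add (u v : Spinors) :
    weightedFourier (u + v) =ᵐ[volume] weightedFourier u + weightedFourier v := by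
  have h : (𝓕 (u + v) : Spinors) = 𝓕 u + 𝓕 v := FourierTransform.fourier_add u v
  filter_upwards [Lp.coeFn_add (𝓕 u : Spinors) (𝓕 v)] with ξ hξ
  simp only [weightedFourier, h, hξ, Pi.add_apply, smul_add]

lemma weightedFourier_smul (c : ℂ) (u : Spinors) :
    weightedFourier (c • u) =ᵐ[volume] c • weightedFourier u := by
  have h : (𝓕 (c • u) : Spinors) = c • 𝓕 u := FourierTransform.fourier_smul c u
  filter_upwards [Lp.coeFn_smul c (𝓕 u : Spinors)] with ξ hξ
  simp [weightedFourier, h, hξ, smul_comm c]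

/-- `H¹(ℝ²) ⊗ ℂ²` as a subspace of `L²(ℝ²) ⊗ ℂ²`. -/
def sobolev : Submodule ℂ Spinors where
  carrier := {u | MemLp (weightedFourier u) 2 volume}
  add_mem' := fun {u v} hu hv => (hu.add hv).ae_eq (weightedFourier_add u v).symm
  zero_mem' := by
    have h := weightedFourier_smul 0 0
    rw [zero_smul, zero_smul] at h
    exact (MemLp.zero : MemLp (0 : Plane → Spin) 2 volume).ae_eq h.symm
  smul_mem' := fun c u hu => (hu.const_smul c).ae_eq (weightedFourier_smul c u).symm

/-- The subspace `sobolev` is Mathlib's Sobolev space of order `1` and exponent `2`. -/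
lemma mem_sobolev_iff (u : Spinors) :
    u ∈ sobolev ↔ TemperedDistribution.MemSobolev 1 2 (u : 𝓢'(Plane, Spin)) := by
  have hg : (fun ξ : Plane => (((1 + ‖ξ‖ ^ 2) ^ ((-1 : ℝ) / 2) : ℝ) : ℂ)).HasTemperateGrowth := by
    fun_prop
  have hgb : MemLp (fun ξ : Plane => (((1 + ‖ξ‖ ^ 2) ^ ((-1 : ℝ) / 2) : ℝ) : ℂ)) ⊤ volume := by
    refine memLp_top_of_bound hg.1.continuous.aestronglyMeasurable 1 (Eventually.of_forall ?_)
    intro ξ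
    rw [Complex.norm_real, Real.norm_eq_abs, abs_of_nonneg (by positivity)]
    exact Real.rpow_le_one_of_one_le_of_nonpos (by nlinarith [sq_nonneg ‖ξ‖]) (by norm_num)
  have hmul : ∀ ξ : Plane,
      (1 + ‖ξ‖ ^ 2) ^ ((1 : ℝ) / 2) * (1 + ‖ξ‖ ^ 2) ^ ((-1 : ℝ) / 2) = (1 : ℝ) := by
    intro ξ
    rw [← Real.rpow_add (by positivity)]
    norm_num
  have hinv : ∀ w : 𝓢'(Plane, Spin), TemperedDistribution.smulLeftCLM Spin
      (fun ξ : Plane => (((1 + ‖ξ‖ ^ 2) ^ ((-1 : ℝ) / 2) : ℝ) : ℂ))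
      (TemperedDistribution.smulLeftCLM Spin
        (fun ξ : Plane => (((1 + ‖ξ‖ ^ 2) ^ ((1 : ℝ) / 2) : ℝ) : ℂ)) w) = w ∧
      TemperedDistribution.smulLeftCLM Spin
      (fun ξ : Plane => (((1 + ‖ξ‖ ^ 2) ^ ((1 : ℝ) / 2) : ℝ) : ℂ))
      (TemperedDistribution.smulLeftCLM Spin
        (fun ξ : Plane => (((1 + ‖ξ‖ ^ 2) ^ ((-1 : ℝ) / 2) : ℝ) : ℂ)) w) = w := by
    intro w
    constructor
    all_goals
      rw [TemperedDistribution.smulLeftCLM_smulLeftCLM_apply (by fun_prop) (by fun_prop)]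
      convert! TemperedDistribution.smulLeftCLM_const 1 w using 1
      · congr
        ext ξ
        rw [Pi.mul_apply, ← Complex.ofReal_mul]
        first
          | rw [hmul ξ, Complex.ofReal_one]
          | rw [mul_comm, hmul ξ, Complex.ofReal_one]
      · simp
  rw [TemperedDistribution.memSobolev_iff_exists_smulLeftCLM_fourier,
    Lp.fourier_toTemperedDistribution_eq]
  constructor
  · intro hu
    have hf : MemLp (fun ξ : Plane => ((1 + ‖ξ‖ ^ 2) ^ ((1 : ℝ) / 2) : ℝ) • (𝓕 u : Spinors) ξ) 2
        volume := by
      have hu' : MemLp (weightedFourier u) 2 volume := hu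
      refine hu'.of_le ?_ (Eventually.of_forall fun ξ => ?_)
      · have hc : Continuous fun ξ : Plane => (1 + ‖ξ‖ ^ 2) ^ ((1 : ℝ) / 2) :=
          Continuous.rpow_const (by fun_prop) fun ξ => Or.inr (by norm_num)
        exact hc.aestronglyMeasurable.smul (Lp.aestronglyMeasurable (𝓕 u : Spinors))
      · rw [weightedFourier, norm_smul, norm_smul, Real.norm_of_nonneg (by positivity),
          Real.norm_of_nonneg (by positivity), ← Real.sqrt_eq_rpow]
        refine mul_le_mul_of_nonneg_right (Real.sqrt_le_sqrt ?_) (norm_nonneg _)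
        have h1 : (1 : ℝ) ≤ 2 * Real.pi := by linarith [Real.pi_gt_three]
        have h2 : ‖ξ‖ ≤ 2 * Real.pi * ‖ξ‖ := le_mul_of_one_le_left (norm_nonneg ξ) h1
        have h3 := pow_le_pow_left₀ (norm_nonneg ξ) h2 2
        linarith
    refine ⟨hf.toLp _, ?_⟩
    have h1 : (hgb.toLp _ • hf.toLp _ : Lp Spin 2 (volume : Measure Plane)) = 𝓕 u := by
      refine Lp.ext ?_
      filter_upwards [Lp.coeFn_lpSMul (r := 2) (hgb.toLp _) (hf.toLp _), hgb.coeFn_toLp,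
        hf.coeFn_toLp] with ξ e1 e2 e3
      rw [e1, Pi.smul_apply', e2, e3, Complex.coe_smul, smul_smul, mul_comm, hmul ξ, one_smul]
    have h2 : ((𝓕 u : Spinors) : 𝓢'(Plane, Spin)) = _ :=
      (congrArg _ h1.symm).trans (Lp.toTemperedDistribution_smul_eq hg hgb _)
    rw [h2]
    exact (hinv _).2
  · rintro ⟨f', hf'⟩
    have h1 : (hgb.toLp _ • f' : Lp Spin 2 (volume : Measure Plane)) = 𝓕 u := by
      have h2 : ((hgb.toLp _ • f' : Lp Spin 2 (volume : Measure Plane)) : 𝓢'(Plane, Spin)) =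
          ((𝓕 u : Spinors) : 𝓢'(Plane, Spin)) := by
        rw [Lp.toTemperedDistribution_smul_eq hg hgb, ← hf']
        exact (hinv _).1
      exact LinearMap.ker_eq_bot.mp
        (Lp.ker_toTemperedDistributionCLM_eq_bot (F := Spin) (μ := (volume : Measure Plane))
          (p := 2)) h2
    change MemLp (weightedFourier u) 2 volume
    refine (Lp.memLp f').of_le_mul (c := 2 * Real.pi) ?_ ?_
    · have hc : Continuous fun ξ : Plane => Real.sqrt (1 + (2 * Real.pi * ‖ξ‖) ^ 2) := by
        fun_prop
      exact hc.aestronglyMeasurable.smul (Lp.aestronglyMeasurable (𝓕 u : Spinors))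
    · filter_upwards [Lp.coeFn_lpSMul (r := 2) (hgb.toLp _) f', hgb.coeFn_toLp] with ξ e1 e2
      have e3 : (𝓕 u : Spinors) ξ = (((1 + ‖ξ‖ ^ 2) ^ ((-1 : ℝ) / 2) : ℝ) : ℂ) • f' ξ := by
        rw [← h1, e1, Pi.smul_apply', e2]
      have h3 : Real.sqrt (1 + (2 * Real.pi * ‖ξ‖) ^ 2) ≤
          2 * Real.pi * (1 + ‖ξ‖ ^ 2) ^ ((1 : ℝ) / 2) := by
        rw [← Real.sqrt_eq_rpow]
        refine Real.sqrt_le_iff.mpr ⟨by positivity, ?_⟩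
        rw [mul_pow (2 * Real.pi) (Real.sqrt _), Real.sq_sqrt (by positivity)]
        nlinarith [Real.pi_gt_three, sq_nonneg ‖ξ‖]
      rw [weightedFourier, e3, Complex.coe_smul, smul_smul, norm_smul,
        Real.norm_of_nonneg (by positivity)]
      refine mul_le_mul_of_nonneg_right ?_ (norm_nonneg _)
      calc _ ≤ 2 * Real.pi * (1 + ‖ξ‖ ^ 2) ^ ((1 : ℝ) / 2) * (1 + ‖ξ‖ ^ 2) ^ ((-1 : ℝ) / 2) :=
            mul_le_mul_of_nonneg_right h3 (by positivity)
        _ = 2 * Real.pi := by rw [mul_assoc, hmul ξ, mul_one]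

lemma sobolev_memLp (u : sobolev) : MemLp (weightedFourier u) 2 volume := u.2

/-- The linear map `u ↦ (1 + |2πξ|²)^(1/2) 𝓕 u` from `H¹(ℝ²) ⊗ ℂ²` to `L²(ℝ²) ⊗ ℂ²`. -/
def sobolevWeight : sobolev →ₗ[ℂ] Spinors where
  toFun u := (sobolev_memLp u).toLp _
  map_add' u v := by
    rw [← MemLp.toLp_add]
    exact MemLp.toLp_congr _ _ (weightedFourier_add u v)
  map_smul' c u := by
    rw [RingHom.id_apply, ← MemLp.toLp_const_smul]
    exact MemLp.toLp_congr _ _ (weightedFourier_smul c u)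

lemma sobolevWeight_injective : Function.Injective sobolevWeight := by
  rw [← LinearMap.ker_eq_bot, LinearMap.ker_eq_bot']
  intro u hu
  have h1 : (𝓕 (u : Spinors) : Spinors) = 0 := by
    refine Lp.ext ?_
    have h2 := (sobolev_memLp u).coeFn_toLp
    have h3 : ((sobolev_memLp u).toLp _ : Spinors) = 0 := hu
    rw [h3] at h2
    filter_upwards [h2, Lp.coeFn_zero Spin 2 (volume : Measure Plane)] with ξ e1 e2
    rw [e2] at e1 ⊢
    have h4 : Real.sqrt (1 + (2 * Real.pi * ‖ξ‖) ^ 2) ≠ 0 := by positivity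
    exact (smul_eq_zero.mp e1.symm).resolve_left h4
  have h2 : (u : Spinors) = 0 := by
    rw [← norm_eq_zero, ← Lp.norm_fourier_eq, h1, norm_zero]
  exact Subtype.ext h2

/-- The space `H¹(ℝ²) ⊗ ℂ²` with its own norm,
`‖u‖² = ∫ (1 + |2πξ|²) |𝓕 u (ξ)|² dξ = ∫ |u|² dx + ∫ |∇u|² dx`. -/
def H1 : Type := sobolev

instance : AddCommGroup H1 := inferInstanceAs (AddCommGroup sobolev)

instance : Module ℂ H1 := inferInstanceAs (Module ℂ sobolev)

/-- The identity, from the subspace of `L²` to the space with the `H¹` norm. -/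
def toH1 : sobolev ≃ₗ[ℂ] H1 := LinearEquiv.refl ℂ sobolev

/-- The linear map `sobolevWeight` on `H1`. -/
def H1Weight : H1 →ₗ[ℂ] Spinors := sobolevWeight.comp toH1.symm.toLinearMap

instance : NormedAddCommGroup H1 :=
  NormedAddCommGroup.induced H1 Spinors H1Weight
    (sobolevWeight_injective.comp toH1.symm.injective)

instance : NormedSpace ℂ H1 := NormedSpace.induced ℂ H1 Spinors H1Weight

/-- The embedding of the Schwartz spinors into `H¹(ℝ²) ⊗ ℂ²`. -/
def schwartzToH1 : 𝓢(Plane, Spin) →ₗ[ℂ] H1 :=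
  toH1.toLinearMap.comp
    (LinearMap.codRestrict sobolev
      (SchwartzMap.toLpCLM ℂ Spin 2 (volume : Measure Plane)).toLinearMap
      fun φ => (mem_sobolev_iff _).mpr (by
        have h := SchwartzMap.memSobolev (s := 1) (p := 2) φ
        rwa [← Lp.toTemperedDistribution_toLp_eq (p := 2)] at h))

/-! ### The perturbed form -/

/-- The bounded map `J₂ : H¹(ℝ²) ⊗ ℂ² → L²(ℝ², m) ⊗ ℂ²`, the continuous extension of the identity
map `φ ↦ φ` on Schwartz spinors. -/
def J2 (m : Measure Plane) [IsFiniteMeasure m] : H1 →L[ℂ] SpinL2 m :=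
  (SchwartzMap.toLpCLM ℂ Spin 2 m).toLinearMap.extendOfNorm schwartzToH1

/-- The form `q₀` of `H₀`, with domain `H¹(ℝ²) ⊗ ℂ²`. -/
def formH0 (A : Plane → ℂ) (u v : sobolev) : ℂ :=
  ∫ ξ, inner ℂ ((𝓕 (u : Spinors) : Spinors) ξ) (symbolFourier A v ξ)

/-- The form of the measure `ν = h m`: `ν(u, v) = ∫ h(x) ⟪J₂ u (x), J₂ v (x)⟫ m(dx)`. -/
def formNu (m : Measure Plane) [IsFiniteMeasure m] (h : Plane → ℝ) (u v : sobolev) : ℂ :=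
  ∫ x, (h x : ℂ) * inner ℂ (J2 m (toH1 u) x) (J2 m (toH1 v) x) ∂m

/-- The form `q = q₀ + ν` with domain `H¹(ℝ²) ⊗ ℂ²`. -/
def formH (A : Plane → ℂ) (m : Measure Plane) [IsFiniteMeasure m] (h : Plane → ℝ)
    (u v : sobolev) : ℂ :=
  formH0 A u v + formNu m h u v

/-- The inequality
`∫ (1 + h²) |f|² dm ≤ a ∫ |∇f|² dx + b ∫ |f|² dx` for all complex Schwartz functions `f`. -/
def FormBound (m : Measure Plane) (h : Plane → ℝ) (a b : ℝ) : Prop :=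
  ∀ f : 𝓢(Plane, ℂ),
    ∫ x, (1 + h x ^ 2) * ‖f x‖ ^ 2 ∂m ≤
      a * (∫ x, ∑ i : Fin 2, ‖fderiv ℝ f x (EuclideanSpace.single i 1)‖ ^ 2) +
        b * (∫ x, ‖f x‖ ^ 2)

/-- `limsup |A(p)| / p²` as `p → ∞`. -/
def limsupRatio (A : Plane → ℂ) : ℝ≥0∞ :=
  limsup (fun p => ENNReal.ofReal (‖A p‖ / ‖p‖ ^ 2)) (cocompact Plane)

end SpinOrbit

end

/-!
The map `u ↦ f = (1 + |2πξ|²)^(1/2) 𝓕 u` identifies `H¹` isometrically with `L²`; let `Λ` be its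
inverse, viewed as a bounded injective operator of `L²` with dense range (`sobolevCoord`). In the
coordinate `f` each form `q` on `H¹` is `⟪f, N g⟫` with a bounded self-adjoint `N`, and the shifted
form `q + r ‖·‖²` is represented by `B = N + r Λ† Λ`. For `H₀` this `N` is multiplication by
`Ĥ₀ / (1 + |p|²)`, and `ν` adds `J† h J`, where `J` is `J₂` in the coordinate `f` (`traceCoord`).

Semiboundedness and closedness of `q` are equivalent to the coercivity of `B` for large `r`: one
direction (`semibounded_and_closed_of_coercive`) is completeness of `L²`, the other
(`exists_forall_coercive`) is the open mapping theorem for `B^(1/2)`. Since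
`2 |∫ h |J₂ u|² dm| ≤ ∫ (1 + h²) |J₂ u|² dm ≤ a ‖∇u‖² + b ‖u‖²`
and `|A(p)| ≤ (1 - a/2 - c) |p|² + C`, the operator `B` is coercive when `θ + a/2 < 1`
(`le_re_inner_rep0`, `FormBound.le_re_inner_repNu`).

If `B` is coercive, then `R = Λ B⁻¹ Λ†` is injective and self-adjoint, and the operator of the form
is `R⁻¹ - r` (`isFormOperator_iff_isResolventAt`, `exists_isSelfAdjoint_isResolventAt`). The
operator `H₀` on its maximal domain is recovered in the same way (`isFormOperator_H0`), with
`B₀` in place of `B`. The difference of the two operators `R` is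
`Λ B⁻¹ J† h (J B₀⁻¹ Λ†)`. Because `B₀` is a multiplication operator in the Fourier picture, the
last factor is a bounded operator followed by the trace on `m` of `𝓕⁻ (g / (1 + |p|²))`. This trace
is Hilbert-Schmidt, as `m` is finite and `(1 + |p|²)⁻¹` is square-integrable in dimension two
(`FormBound.isCompactOperator_trace_divWeight`); the trace on `H¹` itself need not be compact.

For self-adjoint `R` the operator `H - z` is Fredholm exactly when every bounded sequence whose
image under `1 - (z + r) R` converges has a convergent subsequence, and this property survives
compact perturbations of `R` (`essentialSpectrum_eq_of_compact_sub`).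
-/

namespace SpinOrbit

/-! ### Fredholm operators and Weyl's theorem -/

section Fredholm

variable {V : Type*} [NormedAddCommGroup V] [InnerProductSpace ℂ V]

/-- `F` is proper on bounded sets: a bounded sequence whose image converges has a convergent
subsequence. On a Hilbert space this says that `F` is upper semi-Fredholm. -/
def ProperOnBounded (F : V →L[ℂ] V) : Prop :=
  ∀ (u : ℕ → V) (y : V) (C : ℝ), (∀ n, ‖u n‖ ≤ C) → Tendsto (fun n => F (u n)) atTop (𝓝 y) →
    ∃ (x : V) (φ : ℕ → ℕ), StrictMono φ ∧ Tendsto (u ∘ φ) atTop (𝓝 x)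

lemma ProperOnBounded.of_compact_sub {F G : V →L[ℂ] V} (hF : ProperOnBounded F)
    (hFG : IsCompactOperator (F - G)) : ProperOnBounded G := by
  intro u y C hu hy
  obtain ⟨K, hK, hKu⟩ :=
    IsCompactOperator.image_closedBall_subset_compact (f := (F - G).toLinearMap) hFG C
  have hmem : ∀ n, (F - G) (u n) ∈ K := fun n =>
    hKu ⟨u n, by simpa using hu n, rfl⟩
  obtain ⟨w, -, φ, hφ, hw⟩ := hK.tendsto_subseq hmem
  have h1 : Tendsto (fun n => F ((u ∘ φ) n)) atTop (𝓝 (w + y)) := by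
    refine (hw.add (hy.comp hφ.tendsto_atTop)).congr fun n => ?_
    simp
  obtain ⟨x, ψ, hψ, hx⟩ := hF (u ∘ φ) (w + y) C (fun n => hu _) h1
  exact ⟨x, φ ∘ ψ, hφ.comp hψ, hx⟩

variable [CompleteSpace V]

/-- The restriction of `F` to the orthogonal complement of its kernel is injective and has the
same range as `F`. -/
lemma exists_restrict_orthogonal_ker (F : V →L[ℂ] V) :
    Function.Injective (F ∘L (F.kerᗮ).subtypeL) ∧
      Set.range (F ∘L (F.kerᗮ).subtypeL) = (F.range : Set V) := by
  have : CompleteSpace F.ker := (F.isClosed_ker).completeSpace_coe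
  constructor
  · rw [injective_iff_map_eq_zero]
    rintro ⟨x, hx⟩ h0
    have h1 : x ∈ F.ker := h0
    have := (Submodule.inf_orthogonal_eq_bot F.ker).le ⟨h1, hx⟩
    exact Subtype.ext (by simpa using this)
  · ext y
    constructor
    · rintro ⟨x, rfl⟩
      exact ⟨x, rfl⟩
    · rintro ⟨x, rfl⟩
      obtain ⟨a, ha, b, hb, rfl⟩ := F.ker.exists_add_mem_mem_orthogonal x
      refine ⟨⟨b, hb⟩, ?_⟩
      have ha' : F a = 0 := ha
      simp [ha']

lemma properOnBounded_of_finite_ker {F : V →L[ℂ] V} (hker : FiniteDimensional ℂ F.ker)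
    (hran : IsClosed (F.range : Set V)) : ProperOnBounded F := by
  intro u y C hu hy
  obtain ⟨hinj, hrange⟩ := exists_restrict_orthogonal_ker F
  obtain ⟨K, hK⟩ := ContinuousLinearMap.antilipschitz_of_injective_of_isClosed_range
    (F ∘L (F.kerᗮ).subtypeL) hinj (by rw [hrange]; exact hran)
  have hemb := hK.isClosedEmbedding (F ∘L (F.kerᗮ).subtypeL).uniformContinuous
  -- split `u n = a n + b n` along `ker F ⊕ (ker F)ᗮ`: `b n` converges, `a n` is bounded in a
  -- finite-dimensional space
  choose a ha b hb hab using fun n => F.ker.exists_add_mem_mem_orthogonal (u n)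
  have hFb : ∀ n, F (b n) = F (u n) := fun n => by
    have ha' : F (a n) = 0 := ha n
    rw [hab n, map_add, ha', zero_add]
  have hy' : y ∈ Set.range (F ∘L (F.kerᗮ).subtypeL) := by
    rw [hrange]
    exact hran.mem_of_tendsto hy (Eventually.of_forall fun n => ⟨u n, rfl⟩)
  obtain ⟨b₀, rfl⟩ := hy'
  have hbt : Tendsto (fun n => (⟨b n, hb n⟩ : F.kerᗮ)) atTop (𝓝 b₀) := by
    rw [hemb.isEmbedding.tendsto_nhds_iff]
    exact hy.congr fun n => (hFb n).symm
  have hbt' : Tendsto b atTop (𝓝 (b₀ : V)) := (continuous_subtype_val.tendsto _).comp hbt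
  have hac : ∀ n, (⟨a n, ha n⟩ : F.ker) ∈ Metric.closedBall (0 : F.ker) C := fun n => by
    have h1 : inner ℂ (a n) (b n) = 0 := hb n (a n) (ha n)
    have h2 := norm_add_sq_eq_norm_sq_add_norm_sq_of_inner_eq_zero (a n) (b n) h1
    have h3 : ‖a n‖ ≤ ‖u n‖ := by
      rw [hab n]
      refine (mul_self_le_mul_self_iff (norm_nonneg _) (norm_nonneg _)).mpr ?_
      nlinarith [mul_self_nonneg ‖b n‖]
    simpa using h3.trans (hu n)
  have : ProperSpace F.ker := FiniteDimensional.proper ℂ _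
  obtain ⟨a₀, -, φ, hφ, hat⟩ := tendsto_subseq_of_bounded Metric.isBounded_closedBall hac
  refine ⟨(a₀ : V) + b₀, φ, hφ, ?_⟩
  refine (((continuous_subtype_val.tendsto _).comp hat).add
    (hbt'.comp hφ.tendsto_atTop)).congr fun n => ?_
  simp [hab (φ n)]

omit [CompleteSpace V] in
lemma ProperOnBounded.finite_ker {F : V →L[ℂ] V} (hF : ProperOnBounded F) :
    FiniteDimensional ℂ F.ker := by
  refine FiniteDimensional.of_isCompact_closedBall₀ ℂ zero_lt_one ?_
  refine IsSeqCompact.isCompact fun u hu => ?_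
  obtain ⟨x, φ, hφ, hx⟩ := hF (fun n => (u n : V)) 0 1 (fun n => by simpa using hu n)
    (tendsto_const_nhds.congr fun n => by
      have h1 : F (u n) = 0 := (u n).2
      exact h1.symm)
  have hxk : x ∈ F.ker := F.isClosed_ker.mem_of_tendsto hx
    (Eventually.of_forall fun n => (u (φ n)).2)
  have hx' : Tendsto (u ∘ φ) atTop (𝓝 (⟨x, hxk⟩ : F.ker)) := tendsto_subtype_rng.mpr hx
  exact ⟨_, Metric.isClosed_closedBall.mem_of_tendsto hx' (Eventually.of_forall fun n => hu _),
    φ, hφ, hx'⟩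

lemma ProperOnBounded.isClosed_range {F : V →L[ℂ] V} (hF : ProperOnBounded F) :
    IsClosed (F.range : Set V) := by
  obtain ⟨hinj, hrange⟩ := exists_restrict_orthogonal_ker F
  set G := F ∘L (F.kerᗮ).subtypeL with hG
  suffices h : ∃ c : ℝ, 0 < c ∧ ∀ x, c * ‖x‖ ≤ ‖G x‖ by
    obtain ⟨c, hc, hcG⟩ := h
    rw [← hrange]
    refine AntilipschitzWith.isClosed_range (K := ⟨c⁻¹, by positivity⟩) ?_ G.uniformContinuous
    refine G.antilipschitz_of_bound fun x => ?_
    change ‖x‖ ≤ c⁻¹ * ‖G x‖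
    rw [inv_mul_eq_div, le_div_iff₀ hc, mul_comm]
    exact hcG x
  by_contra! hcon
  have hcon' : ∀ n : ℕ, ∃ x : F.kerᗮ, ‖x‖ = 1 ∧ ‖G x‖ < 1 / ((n : ℝ) + 1) := by
    intro n
    obtain ⟨x, hx⟩ := hcon (1 / ((n : ℝ) + 1)) (by positivity)
    have hx0 : 0 < ‖x‖ := by
      rw [norm_pos_iff]
      rintro rfl
      simp at hx
    refine ⟨((‖x‖⁻¹ : ℝ) : ℂ) • x, ?_, ?_⟩
    · rw [norm_smul, Complex.norm_real, norm_inv, norm_norm, inv_mul_cancel₀ hx0.ne']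
    · rw [map_smul, norm_smul, Complex.norm_real, norm_inv, norm_norm, inv_mul_eq_div,
        div_lt_iff₀ hx0]
      exact hx
  choose x hx1 hx2 using hcon'
  have h0 : Tendsto (fun n => G (x n)) atTop (𝓝 0) :=
    squeeze_zero_norm (fun n => (hx2 n).le) tendsto_one_div_add_atTop_nhds_zero_nat
  obtain ⟨y, φ, hφ, hy⟩ := hF (fun n => (x n : V)) 0 1 (fun n => (hx1 n).le) h0
  have hy1 : ‖y‖ = 1 := tendsto_nhds_unique hy.norm
    (tendsto_const_nhds.congr fun n => (hx1 (φ n)).symm)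
  have hyo : y ∈ F.kerᗮ := (Submodule.isClosed_orthogonal _).mem_of_tendsto hy
    (Eventually.of_forall fun n => (x (φ n)).2)
  have hyk : G ⟨y, hyo⟩ = 0 := tendsto_nhds_unique ((F.continuous.tendsto y).comp hy)
    (h0.comp hφ.tendsto_atTop)
  have hy0 : (⟨y, hyo⟩ : F.kerᗮ) = 0 := hinj (by rw [hyk, map_zero])
  have : y = 0 := congrArg Subtype.val hy0
  rw [this, norm_zero] at hy1
  exact zero_ne_one hy1

/-- For a self-adjoint `R`, the operator `1 - ζ R` is normal, so its cokernel is as large as its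
kernel as soon as its range is closed. -/
lemma finite_coker_one_sub_smul {R : V →L[ℂ] V} (hR : IsSelfAdjoint R) (ζ : ℂ)
    (hker : FiniteDimensional ℂ (1 - ζ • R).ker)
    (hran : IsClosed ((1 - ζ • R).range : Set V)) :
    FiniteDimensional ℂ (V ⧸ (1 - ζ • R).range) := by
  have hn : IsStarNormal (1 - ζ • R) := by
    constructor
    have : star (1 - ζ • R) = 1 - (starRingEnd ℂ ζ) • R := by
      rw [star_sub, star_one, star_smul, hR.star_eq]; rfl
    rw [this]
    refine Commute.sub_left (Commute.one_left _) (Commute.sub_right (Commute.one_right _) ?_)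
    exact ((Commute.refl R).smul_left _).smul_right _
  have : CompleteSpace ((1 - ζ • R).range) := hran.completeSpace_coe
  have h1 : (1 - ζ • R).rangeᗮ = (1 - ζ • R).ker :=
    ContinuousLinearMap.IsStarNormal.orthogonal_range hn
  have h2 : FiniteDimensional ℂ ((1 - ζ • R).rangeᗮ : Submodule ℂ V) := by rw [h1]; exact hker
  exact Module.Finite.equiv (Submodule.quotientEquivOfIsCompl _ _
    (Submodule.isCompl_orthogonal
      (K := (1 - ζ • R).range))).symm

/-- `R` is the bounded inverse of `T + r`. -/
def IsResolventAt (T : V →ₗ.[ℂ] V) (r : ℝ) (R : V →L[ℂ] V) : Prop :=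
  ∀ u w : V, (u, w) ∈ T.graph ↔ u = R (w + (r : ℂ) • u)

omit [CompleteSpace V] in
/-- If `R = (T + r)⁻¹`, then `T - z`, transported by `R`, is the bounded operator
`1 - (z + r) R`. -/
lemma IsResolventAt.exists_equiv {T : V →ₗ.[ℂ] V} {r : ℝ} {R : V →L[ℂ] V}
    (hT : IsResolventAt T r R) (z : ℂ) :
    ∃ e : V ≃ₗ[ℂ] T.domain, (shift T z) ∘ₗ e.toLinearMap = (1 - (z + r) • R : V →L[ℂ] V) := by
  have hmem : ∀ s : V, (R s, s - (r : ℂ) • R s) ∈ T.graph := fun s => by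
    rw [hT]; simp
  have hdom : ∀ s : V, R s ∈ T.domain := fun s => LinearPMap.mem_domain_of_mem_graph (hmem s)
  have hval : ∀ s : V, T ⟨R s, hdom s⟩ = s - (r : ℂ) • R s := fun s => by
    have := (LinearPMap.mem_graph_iff T).mp (hmem s)
    obtain ⟨y, hy1, hy2⟩ := this
    refine Eq.trans ?_ hy2
    exact congrArg _ (Subtype.ext hy1.symm)
  let e₀ : V →ₗ[ℂ] T.domain := R.toLinearMap.codRestrict T.domain hdom
  have hbij : Function.Bijective e₀ := by
    constructor
    · rw [injective_iff_map_eq_zero]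
      intro s hs
      have h0 : R s = 0 := congrArg Subtype.val hs
      have h1 := hval s
      have h2 : (⟨R s, hdom s⟩ : T.domain) = 0 := Subtype.ext h0
      rw [h2, h0, LinearPMap.map_zero, smul_zero, sub_zero] at h1
      exact h1.symm
    · intro u
      refine ⟨T u + (r : ℂ) • u, Subtype.ext ?_⟩
      exact ((hT u (T u)).mp (LinearPMap.mem_graph T u)).symm
  refine ⟨LinearEquiv.ofBijective e₀ hbij, LinearMap.ext fun s => ?_⟩
  have h1 : shift T z (e₀ s) = T ⟨R s, hdom s⟩ - z • R s := rfl
  change shift T z (e₀ s) = s - (z + r) • R s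
  rw [h1, hval, add_smul]
  abel

lemma IsResolventAt.isFredholmAt_iff {T : V →ₗ.[ℂ] V} {r : ℝ} {R : V →L[ℂ] V}
    (hT : IsResolventAt T r R) (hR : IsSelfAdjoint R) (z : ℂ) :
    IsFredholmAt T z ↔ ProperOnBounded (1 - (z + r) • R) := by
  obtain ⟨e, he⟩ := hT.exists_equiv z
  have hrange : LinearMap.range (shift T z) = (1 - (z + r) • R).range := by
    rw [← LinearMap.range_comp_of_range_eq_top (shift T z) (LinearEquiv.range e), he]
  have hker : (1 - (z + r) • R).ker = (LinearMap.ker (shift T z)).comap e.toLinearMap := by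
    rw [← LinearMap.ker_comp, he]
  have hiff : FiniteDimensional ℂ (1 - (z + r) • R).ker ↔
      FiniteDimensional ℂ (LinearMap.ker (shift T z)) := by
    have e' : (1 - (z + r) • R).ker ≃ₗ[ℂ] LinearMap.ker (shift T z) :=
      (LinearEquiv.ofEq _ _ hker).trans (e.ofSubmodule' _)
    exact ⟨fun _ => Module.Finite.equiv e', fun _ => Module.Finite.equiv e'.symm⟩
  constructor
  · rintro ⟨h1, h2, -⟩
    exact properOnBounded_of_finite_ker (hiff.mpr h1) (by rw [← hrange]; exact h2)
  · intro h
    refine ⟨hiff.mp h.finite_ker, by rw [hrange]; exact h.isClosed_range, ?_⟩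
    rw [hrange]
    exact finite_coker_one_sub_smul hR _ h.finite_ker h.isClosed_range

/-- Weyl's theorem: self-adjoint operators whose resolvents differ by a compact operator have the
same essential spectrum. -/
lemma essentialSpectrum_eq_of_compact_sub {T₁ T₂ : V →ₗ.[ℂ] V} {r : ℝ} {R₁ R₂ : V →L[ℂ] V}
    (h₁ : IsResolventAt T₁ r R₁) (h₂ : IsResolventAt T₂ r R₂) (hR₁ : IsSelfAdjoint R₁)
    (hR₂ : IsSelfAdjoint R₂) (hc : IsCompactOperator (R₁ - R₂)) :
    essentialSpectrum T₁ = essentialSpectrum T₂ := by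
  ext z
  refine not_congr ?_
  rw [h₁.isFredholmAt_iff hR₁, h₂.isFredholmAt_iff hR₂]
  have hc' : IsCompactOperator ((z + r) • (R₁ - R₂) : V →L[ℂ] V) := hc.smul (z + r : ℂ)
  refine ⟨fun h => h.of_compact_sub ?_, fun h => h.of_compact_sub ?_⟩
  · have : (1 - (z + r) • R₁) - (1 - (z + r) • R₂) = -((z + r) • (R₁ - R₂)) := by
      rw [smul_sub]; abel
    rw [this]
    exact hc'.neg
  · have : (1 - (z + r) • R₂) - (1 - (z + r) • R₁) = (z + r) • (R₁ - R₂) := by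
      rw [smul_sub]; abel
    rw [this]
    exact hc'

end Fredholm

/-! ### Closed forms, their operators, and Hilbert-Schmidt operators -/

section Form

open ContinuousLinearMap (adjoint)

variable {E V : Type*} [NormedAddCommGroup E] [InnerProductSpace ℂ E] [CompleteSpace E]
  [NormedAddCommGroup V] [InnerProductSpace ℂ V] [CompleteSpace V]

/-- The bounded operator `B` is coercive: `Re ⟪f, B f⟫ ≥ c ‖f‖²` for some `c > 0`. -/
def Coercive (B : E →L[ℂ] E) : Prop :=
  ∃ c : ℝ, 0 < c ∧ ∀ f, c * ‖f‖ ^ 2 ≤ (inner ℂ f (B f)).re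

/-- If the form `q` is `⟪f, N f⟫` in the coordinate `u = Λ f`, this is the operator representing
the shifted form `q + r ‖·‖²`. -/
noncomputable def shiftedRep (Λ : E →L[ℂ] V) (N : E →L[ℂ] E) (r : ℝ) : E →L[ℂ] E :=
  N + (r : ℂ) • (adjoint Λ ∘L Λ)

lemma shiftedRep_apply (Λ : E →L[ℂ] V) (N : E →L[ℂ] E) (r : ℝ) (f : E) :
    shiftedRep Λ N r f = N f + (r : ℂ) • adjoint Λ (Λ f) := rfl

lemma inner_shiftedRep (Λ : E →L[ℂ] V) (N : E →L[ℂ] E) (r : ℝ) (f g : E) :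
    inner ℂ f (shiftedRep Λ N r g) = inner ℂ f (N g) + r * inner ℂ (Λ f) (Λ g) := by
  simp [shiftedRep, ContinuousLinearMap.adjoint_inner_right]

lemma re_inner_shiftedRep (Λ : E →L[ℂ] V) (N : E →L[ℂ] E) (r : ℝ) (f : E) :
    (inner ℂ f (shiftedRep Λ N r f)).re = (inner ℂ f (N f)).re + r * ‖Λ f‖ ^ 2 := by
  rw [inner_shiftedRep, inner_self_eq_norm_sq_to_K, Complex.add_re,
    Complex.re_ofReal_mul]
  norm_cast

lemma isSelfAdjoint_shiftedRep (Λ : E →L[ℂ] V) {N : E →L[ℂ] E} (hN : IsSelfAdjoint N) (r : ℝ) :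
    IsSelfAdjoint (shiftedRep Λ N r) := by
  refine hN.add (IsSelfAdjoint.smul (Complex.conj_ofReal r) ?_)
  exact (ContinuousLinearMap.isPositive_adjoint_comp_self Λ).isSelfAdjoint

lemma Coercive.isUnit {B : E →L[ℂ] E} (hB : Coercive B) : IsUnit B := by
  obtain ⟨c, hc, h⟩ := hB
  refine ContinuousLinearMap.isUnit_of_forall_le_norm_inner_map B (c := ⟨c, hc.le⟩) hc fun f => ?_
  have h1 : (inner ℂ f (B f)).re ≤ ‖inner ℂ (B f) f‖ := by
    rw [norm_inner_symm]
    exact Complex.re_le_norm _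
  have h2 := (h f).trans h1
  change ‖f‖ ^ 2 * c ≤ _
  linarith

variable {D : Submodule ℂ V} {q : D → D → ℂ} {Λ : E →L[ℂ] V} {ℓ : E ≃ₗ[ℂ] D} {N : E →L[ℂ] E}

/-- A form dominating the norm of the coordinate `f`, up to a multiple of `‖u‖²`, is semibounded
and closed. -/
lemma semibounded_and_closed_of_coercive (hℓ : ∀ f, (ℓ f : V) = Λ f)
    (hq : ∀ f g, q (ℓ f) (ℓ g) = inner ℂ f (N g)) {r : ℝ}
    (hB : Coercive (shiftedRep Λ N r)) : FormSemibounded D q ∧ FormClosed D q := by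
  obtain ⟨c, hc, h⟩ := hB
  simp_rw [re_inner_shiftedRep] at h
  constructor
  · refine ⟨-r, fun u => ?_⟩
    obtain ⟨f, rfl⟩ := ℓ.surjective u
    rw [hq, hℓ]
    nlinarith [h f, sq_nonneg ‖f‖]
  · intro u x hx hqu
    obtain ⟨f, rfl⟩ : ∃ f : ℕ → E, u = fun n => ℓ (f n) :=
      ⟨fun n => ℓ.symm (u n), funext fun n => (ℓ.apply_symm_apply _).symm⟩
    simp_rw [hℓ] at hx
    simp_rw [← map_sub, hq] at hqu
    -- coercivity turns form convergence into convergence of the coordinates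
    have hlim : Tendsto (fun k : ℕ × ℕ => c⁻¹ * ((inner ℂ (f k.1 - f k.2) (N (f k.1 - f k.2))).re +
        r * ‖Λ (f k.1) - Λ (f k.2)‖ ^ 2)) atTop (𝓝 0) := by
      have h1 := (Complex.continuous_re.tendsto _).comp hqu
      have h2 : Tendsto (fun k : ℕ × ℕ => Λ (f k.1) - Λ (f k.2)) atTop (𝓝 (x - x)) := by
        rw [← prod_atTop_atTop_eq]
        exact (hx.comp tendsto_fst).sub (hx.comp tendsto_snd)
      have h3 := (h1.add ((h2.norm.pow 2).const_mul r)).const_mul c⁻¹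
      simpa using h3
    have hf : CauchySeq f := by
      rw [cauchySeq_iff_tendsto_dist_atTop_0]
      have h4 : Tendsto (fun k : ℕ × ℕ => ‖f k.1 - f k.2‖ ^ 2) atTop (𝓝 0) := by
        refine squeeze_zero (fun k => by positivity) (fun k => ?_) hlim
        have := h (f k.1 - f k.2)
        rw [map_sub Λ] at this
        rw [inv_mul_eq_div, le_div_iff₀ hc, mul_comm]
        exact this
      have h5 := h4.sqrt
      simpa [dist_eq_norm, Real.sqrt_sq] using h5
    obtain ⟨f₀, hf₀⟩ := cauchySeq_tendsto_of_complete hf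
    have hx₀ : x = Λ f₀ := tendsto_nhds_unique hx ((Λ.continuous.tendsto f₀).comp hf₀)
    have hxD : x ∈ D := by rw [hx₀, ← hℓ]; exact (ℓ f₀).2
    have hxe : (⟨x, hxD⟩ : D) = ℓ f₀ := Subtype.ext (hx₀.trans (hℓ f₀).symm)
    refine ⟨hxD, ?_⟩
    simp_rw [hxe, ← map_sub ℓ, hq]
    have h6 : Tendsto (fun n => f n - f₀) atTop (𝓝 0) := by
      simpa using hf₀.sub_const f₀
    have h7 := h6.inner (𝕜 := ℂ) ((N.continuous.tendsto _).comp h6)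
    simpa only [Function.comp_def, map_zero, inner_zero_left] using h7

/-- If a semibounded form is closed, then the form norm is equivalent to the norm of the
coordinate. Writing the shifted form as `‖S f‖²`, closedness of the form says that the injective
operator `S` has closed range. -/
lemma exists_forall_coercive (hℓ : ∀ f, (ℓ f : V) = Λ f)
    (hΛ : Function.Injective Λ)
    (hq : ∀ f g, q (ℓ f) (ℓ g) = inner ℂ f (N g)) (hN : IsSelfAdjoint N)
    (hsemi : FormSemibounded D q) (hclosed : FormClosed D q) :
    ∃ r₀ : ℝ, ∀ r, r₀ ≤ r → Coercive (shiftedRep Λ N r) := by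
  obtain ⟨c, hc⟩ := hsemi
  refine ⟨1 - c, fun r hr => ?_⟩
  set B := shiftedRep Λ N r with hBdef
  have hBsa : IsSelfAdjoint B := isSelfAdjoint_shiftedRep Λ hN r
  have hBge : ∀ f, ‖Λ f‖ ^ 2 ≤ (inner ℂ f (B f)).re := fun f => by
    have h1 := hc (ℓ f)
    rw [hq, hℓ] at h1
    rw [hBdef, re_inner_shiftedRep]
    nlinarith [sq_nonneg ‖Λ f‖]
  have hBpos : 0 ≤ B := by
    rw [ContinuousLinearMap.nonneg_iff_isPositive, ContinuousLinearMap.isPositive_def']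
    refine ⟨hBsa, fun f => ?_⟩
    rw [ContinuousLinearMap.reApplyInnerSelf_apply, ← inner_re_symm]
    exact (sq_nonneg _).trans (hBge f)
  set S := CFC.sqrt B with hS
  have hSsa : IsSelfAdjoint S := (CFC.sqrt_nonneg B).isSelfAdjoint
  have hSS : ∀ f, S (S f) = B f := fun f => by
    have := CFC.sqrt_mul_sqrt_self B hBpos
    exact congrArg (fun T : E →L[ℂ] E => T f) this
  have hSnorm : ∀ f, ‖S f‖ ^ 2 = (inner ℂ f (B f)).re := fun f => by
    rw [← hSS, ← ContinuousLinearMap.adjoint_inner_left, hSsa.adjoint_eq,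
      inner_self_eq_norm_sq_to_K]
    norm_cast
  have hSΛ : ∀ f, ‖Λ f‖ ≤ ‖S f‖ := fun f => by
    refine (pow_le_pow_iff_left₀ (norm_nonneg _) (norm_nonneg _) two_ne_zero).mp ?_
    rw [hSnorm]
    exact hBge f
  -- `q(u, u)` is recovered from `S`, so that convergence of `S f` is form convergence of `Λ f`
  have hqim : ∀ f, q (ℓ f) (ℓ f) = ((‖S f‖ ^ 2 - r * ‖Λ f‖ ^ 2 : ℝ) : ℂ) := fun f => by
    have h1 : inner ℂ f (B f) = ((‖S f‖ ^ 2 : ℝ) : ℂ) := by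
      rw [← hSS, ← ContinuousLinearMap.adjoint_inner_left, hSsa.adjoint_eq,
        inner_self_eq_norm_sq_to_K]
      norm_cast
    have h2 := inner_shiftedRep Λ N r f f
    rw [← hBdef, h1, ← hq, inner_self_eq_norm_sq_to_K] at h2
    rw [Complex.ofReal_sub, h2]
    push_cast
    ring_nf
    simp
  have hSinj : Function.Injective S := by
    rw [injective_iff_map_eq_zero]
    intro f hf
    have h1 := hSΛ f
    rw [hf, norm_zero] at h1
    exact hΛ (by rw [norm_le_zero_iff.mp h1, map_zero])
  have hSran : IsClosed (Set.range S) := by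
    rw [← isSeqClosed_iff_isClosed]
    intro v y hv hy
    choose f hf using hv
    obtain rfl : v = fun n => S (f n) := funext fun n => (hf n).symm
    have hSc : Tendsto (fun k : ℕ × ℕ => S (f k.1 - f k.2)) atTop (𝓝 0) := by
      have : Tendsto (fun k : ℕ × ℕ => S (f k.1) - S (f k.2)) atTop (𝓝 (y - y)) := by
        rw [← prod_atTop_atTop_eq]
        exact (hy.comp tendsto_fst).sub (hy.comp tendsto_snd)
      simpa using this
    have hΛc : Tendsto (fun k : ℕ × ℕ => Λ (f k.1 - f k.2)) atTop (𝓝 0) :=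
      squeeze_zero_norm (fun k => hSΛ _) (by simpa using hSc.norm)
    have hcau : CauchySeq fun n => Λ (f n) := by
      rw [cauchySeq_iff_tendsto_dist_atTop_0]
      simpa [dist_eq_norm] using hΛc.norm
    obtain ⟨x, hx⟩ := cauchySeq_tendsto_of_complete hcau
    have hform : ∀ {ι : Type} {L : Filter ι} (g : ι → E), Tendsto (fun i => S (g i)) L (𝓝 0) →
        Tendsto (fun i => Λ (g i)) L (𝓝 0) → Tendsto (fun i => q (ℓ (g i)) (ℓ (g i))) L (𝓝 0) := by
      intro ι L g h1 h2
      simp_rw [hqim]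
      have h3 := (h1.norm.pow 2).sub ((h2.norm.pow 2).const_mul r)
      have h4 := (Complex.continuous_ofReal.tendsto _).comp h3
      simpa [Function.comp_def] using h4
    obtain ⟨hxD, hqx⟩ := hclosed (fun n => ℓ (f n)) x (by simpa only [hℓ] using hx)
      (by simpa only [← map_sub] using hform _ hSc hΛc)
    obtain ⟨f₀, hf₀⟩ := ℓ.surjective ⟨x, hxD⟩
    have hΛf₀ : Λ f₀ = x := by rw [← hℓ, hf₀]
    rw [← hf₀] at hqx
    simp_rw [← map_sub ℓ, hqim] at hqx
    have hΛ0 : Tendsto (fun n => Λ (f n - f₀)) atTop (𝓝 0) := by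
      simpa [hΛf₀] using hx.sub_const x
    have hS0 : Tendsto (fun n => ‖S (f n - f₀)‖ ^ 2) atTop (𝓝 0) := by
      have h3 := ((Complex.continuous_re.tendsto _).comp hqx).add
        ((hΛ0.norm.pow 2).const_mul r)
      simpa only [Function.comp_def, Complex.ofReal_re, sub_add_cancel, Complex.zero_re, norm_zero,
        ne_eq, OfNat.ofNat_ne_zero, not_false_eq_true, zero_pow, mul_zero, add_zero] using h3
    have hS1 : Tendsto (fun n => S (f n) - S f₀) atTop (𝓝 0) := by
      rw [tendsto_zero_iff_norm_tendsto_zero]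
      have := hS0.sqrt
      simpa [Real.sqrt_sq] using this
    refine ⟨f₀, ?_⟩
    exact (tendsto_nhds_unique hy (by simpa using hS1.add_const (S f₀))).symm
  obtain ⟨K, hK⟩ := ContinuousLinearMap.antilipschitz_of_injective_of_isClosed_range S hSinj hSran
  have hK' : ∀ f, ‖f‖ ≤ K * ‖S f‖ := fun f => by simpa using hK.le_mul_dist f 0
  refine ⟨((K : ℝ) ^ 2 + 1)⁻¹, by positivity, fun f => ?_⟩
  rw [← hSnorm, inv_mul_eq_div, div_le_iff₀ (by positivity)]
  have h1 := pow_le_pow_left₀ (norm_nonneg f) (hK' f) 2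
  rw [mul_pow] at h1
  nlinarith [sq_nonneg ‖S f‖]

/-- The inverse of `H + r`, where `H` is the operator of the form with shifted
representative `B`. -/
noncomputable def formResolvent (Λ : E →L[ℂ] V) (B : E →L[ℂ] E) : V →L[ℂ] V :=
  Λ ∘L Ring.inverse B ∘L adjoint Λ

lemma isSelfAdjoint_formResolvent {B : E →L[ℂ] E} (hB : IsSelfAdjoint B) :
    IsSelfAdjoint (formResolvent Λ B) := by
  have h1 : IsSelfAdjoint (Ring.inverse B) := by
    rw [IsSelfAdjoint, ← Ring.inverse_star, hB.star_eq]
  have h2 : adjoint (Ring.inverse B) = Ring.inverse B := h1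
  rw [formResolvent, ContinuousLinearMap.isSelfAdjoint_iff']
  rw [ContinuousLinearMap.adjoint_comp, ContinuousLinearMap.adjoint_comp,
    ContinuousLinearMap.adjoint_adjoint, h2]
  rfl

lemma isFormOperator_iff_isResolventAt (hℓ : ∀ f, (ℓ f : V) = Λ f)
    (hq : ∀ f g, q (ℓ f) (ℓ g) = inner ℂ f (N g)) {r : ℝ}
    (hB : IsUnit (shiftedRep Λ N r)) (T : V →ₗ.[ℂ] V) :
    IsFormOperator D q T ↔ IsResolventAt T r (formResolvent Λ (shiftedRep Λ N r)) := by
  refine forall₂_congr fun u w => ?_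
  refine iff_congr Iff.rfl ?_
  set B := shiftedRep Λ N r with hBdef
  have hinv1 : ∀ f, Ring.inverse B (B f) = f := fun f =>
    congrArg (fun T : E →L[ℂ] E => T f) (Ring.inverse_mul_cancel B hB)
  have hinv2 : ∀ f, B (Ring.inverse B f) = f := fun f =>
    congrArg (fun T : E →L[ℂ] E => T f) (Ring.mul_inverse_cancel B hB)
  -- the weak equation for `u = Λ g`, tested with all of `D = ran Λ`
  have key : ∀ g : E, (∀ v : D, q v (ℓ g) = inner ℂ (v : V) w) ↔
      B g = adjoint Λ (w + (r : ℂ) • Λ g) := by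
    intro g
    rw [hBdef, shiftedRep_apply, map_add, map_smul, add_left_inj]
    constructor
    · intro h
      refine ext_inner_left ℂ fun f => ?_
      rw [← hq, h, hℓ, ContinuousLinearMap.adjoint_inner_right]
    · intro h v
      obtain ⟨f, rfl⟩ := ℓ.surjective v
      rw [hq, h, hℓ, ContinuousLinearMap.adjoint_inner_right]
  constructor
  · rintro ⟨hu, h⟩
    obtain ⟨g, hg⟩ := ℓ.surjective ⟨u, hu⟩
    have hgu : Λ g = u := by rw [← hℓ, hg]
    rw [← hg, key, hgu] at h
    change u = Λ (Ring.inverse B (adjoint Λ (w + (r : ℂ) • u)))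
    rw [← h, hinv1, hgu]
  · intro h
    set g := Ring.inverse B (adjoint Λ (w + (r : ℂ) • u)) with hg
    have hgu : Λ g = u := h.symm
    have hu : u ∈ D := by rw [← hgu, ← hℓ]; exact (ℓ g).2
    have hgu' : (⟨u, hu⟩ : D) = ℓ g := Subtype.ext (by rw [hℓ, hgu])
    refine ⟨hu, ?_⟩
    rw [hgu', key, hgu, hg, hinv2]

lemma formResolvent_injective (hΛd : DenseRange Λ) {B : E →L[ℂ] E}
    (hB : Coercive B) : Function.Injective (formResolvent Λ B) := by
  rw [injective_iff_map_eq_zero]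
  intro w hw
  have hu := hB.isUnit
  obtain ⟨c, hc, h⟩ := hB
  set g := Ring.inverse B (adjoint Λ w) with hg
  have hBg : B g = adjoint Λ w :=
    congrArg (fun T : E →L[ℂ] E => T (adjoint Λ w)) (Ring.mul_inverse_cancel B hu)
  have hΛg : Λ g = 0 := hw
  have h1 := h g
  rw [hBg, ContinuousLinearMap.adjoint_inner_right, hΛg, inner_zero_left, Complex.zero_re] at h1
  have h2 : g = 0 := by
    have : ‖g‖ ^ 2 ≤ 0 := by nlinarith
    simpa using this
  have h3 : adjoint Λ w = 0 := by rw [← hBg, h2, map_zero]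
  refine hΛd.eq_zero_of_inner_right ℂ fun f => ?_
  rw [← ContinuousLinearMap.adjoint_inner_right, h3, inner_zero_right]

/-- An injective bounded self-adjoint operator `R` is `(T + r)⁻¹` for a self-adjoint `T`. -/
lemma exists_isSelfAdjoint_isResolventAt {R : V →L[ℂ] V} (hR : IsSelfAdjoint R)
    (hinj : Function.Injective R) (r : ℝ) :
    ∃ T : V →ₗ.[ℂ] V, IsResolventAt T r R ∧ IsSelfAdjoint T := by
  let g : Submodule ℂ (V × V) := LinearMap.ker (LinearMap.fst ℂ V V -
    R.toLinearMap ∘ₗ (LinearMap.snd ℂ V V + (r : ℂ) • LinearMap.fst ℂ V V))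
  have hmem : ∀ u w : V, (u, w) ∈ g ↔ u = R (w + (r : ℂ) • u) := fun u w => by
    rw [LinearMap.mem_ker]
    exact sub_eq_zero
  have hgraph : g.toLinearPMap.graph = g := by
    refine Submodule.toLinearPMap_graph_eq g ?_
    rintro ⟨u, w⟩ hx (rfl : u = 0)
    rw [hmem, smul_zero, add_zero] at hx
    exact hinj (by rw [← hx, map_zero])
  have hres : IsResolventAt g.toLinearPMap r R := fun u w => by rw [hgraph, hmem]
  have hsym : ∀ x y : V, inner ℂ (R x) y = inner ℂ x (R y) := fun x y => by
    rw [← ContinuousLinearMap.adjoint_inner_left, hR.adjoint_eq]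
  have hRmem : ∀ s : V, (R s, s - (r : ℂ) • R s) ∈ g := fun s => by
    rw [hmem, sub_add_cancel]
  have hdense : Dense (g.toLinearPMap.domain : Set V) := by
    rw [Submodule.dense_iff_topologicalClosure_eq_top, Submodule.topologicalClosure_eq_top_iff,
      Submodule.eq_bot_iff]
    intro x hx
    refine hinj ?_
    rw [map_zero]
    refine ext_inner_left ℂ fun s => ?_
    rw [← hsym, inner_zero_right]
    refine hx (R s) (LinearPMap.mem_domain_of_mem_graph (y := s - (r : ℂ) • R s) ?_)
    rw [hgraph]
    exact hRmem s
  refine ⟨g.toLinearPMap, hres, ?_⟩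
  rw [LinearPMap.isSelfAdjoint_def]
  refine LinearPMap.eq_of_eq_graph ?_
  rw [LinearPMap.adjoint_graph_eq_graph_adjoint hdense, hgraph]
  ext ⟨y, y'⟩
  rw [Submodule.mem_adjoint_iff, hmem]
  have hid : ∀ s : V, inner ℂ (s - (r : ℂ) • R s) y - inner ℂ (R s) y' =
      inner ℂ s (y - R (y' + (r : ℂ) • y)) := fun s => by
    rw [inner_sub_left, inner_smul_left, Complex.conj_ofReal, hsym, hsym, inner_sub_right,
      map_add, map_smul, inner_add_right, inner_smul_right]
    ring
  constructor
  · intro h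
    rw [← sub_eq_zero]
    refine ext_inner_left ℂ fun s => ?_
    rw [← hid, inner_zero_right]
    exact h _ _ (hRmem s)
  · intro h a b hab
    rw [hmem] at hab
    have hs := hid (b + (r : ℂ) • a)
    rw [← hab, add_sub_cancel_right, ← h, sub_self, inner_zero_right] at hs
    exact hs

variable {G : Type*} [NormedAddCommGroup G] [InnerProductSpace ℂ G] [CompleteSpace G]

/-- The operator `T† M T`, which represents the form `⟪T f, M T g⟫`. -/
noncomputable def pullback (T : E →L[ℂ] G) (M : G →L[ℂ] G) : E →L[ℂ] E :=
  adjoint T ∘L M ∘L T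

lemma pullback_apply (T : E →L[ℂ] G) (M : G →L[ℂ] G) (f : E) :
    pullback T M f = adjoint T (M (T f)) := rfl

lemma inner_pullback (T : E →L[ℂ] G) (M : G →L[ℂ] G) (f g : E) :
    inner ℂ f (pullback T M g) = inner ℂ (T f) (M (T g)) := by
  rw [pullback_apply, ContinuousLinearMap.adjoint_inner_right]

lemma isSelfAdjoint_pullback (T : E →L[ℂ] G) {M : G →L[ℂ] G} (hM : IsSelfAdjoint M) :
    IsSelfAdjoint (pullback T M) := hM.adjoint_conj T

/-- The resolvent difference `Λ (B₀⁻¹ - B⁻¹) Λ†` for a perturbation `B = B₀ + T† M T` equals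
`Λ B⁻¹ T† M (T B₀⁻¹ Λ†)`; it is enough that its rightmost factor is compact. -/
lemma isCompactOperator_formResolvent_sub {T : E →L[ℂ] G} {M : G →L[ℂ] G} {r : ℝ}
    (hB₀ : IsUnit (shiftedRep Λ N r)) (hB : IsUnit (shiftedRep Λ (N + pullback T M) r))
    (hc : IsCompactOperator (T ∘L Ring.inverse (shiftedRep Λ N r) ∘L adjoint Λ)) :
    IsCompactOperator (formResolvent Λ (shiftedRep Λ N r) -
      formResolvent Λ (shiftedRep Λ (N + pullback T M) r)) := by
  have hsub : ∀ f, shiftedRep Λ (N + pullback T M) r f =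
      shiftedRep Λ N r f + adjoint T (M (T f)) := by
    intro f
    rw [shiftedRep_apply, shiftedRep_apply, ← pullback_apply, add_apply]
    abel
  generalize shiftedRep Λ N r = B₀ at *
  generalize shiftedRep Λ (N + pullback T M) r = B at *
  have hB₀inv : ∀ g, B₀ (Ring.inverse B₀ g) = g := fun g =>
    congrArg (fun T : E →L[ℂ] E => T g) (Ring.mul_inverse_cancel B₀ hB₀)
  have hBinv : ∀ g, Ring.inverse B (B g) = g := fun g =>
    congrArg (fun T : E →L[ℂ] E => T g) (Ring.inverse_mul_cancel B hB)
  have hK := hc.clm_comp (Λ ∘L Ring.inverse B ∘L adjoint T ∘L M)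
  refine (congrArg IsCompactOperator (funext fun v => ?_)).mpr hK
  have h1 := hsub (Ring.inverse B₀ (adjoint Λ v))
  rw [hB₀inv, ← sub_eq_iff_eq_add'] at h1
  change Λ (Ring.inverse B₀ (adjoint Λ v)) - Λ (Ring.inverse B (adjoint Λ v)) =
    Λ (Ring.inverse B (adjoint T (M (T (Ring.inverse B₀ (adjoint Λ v))))))
  rw [← h1, map_sub, map_sub, hBinv]

end Form

section HilbertSchmidt

variable {V G ι : Type*} [NormedAddCommGroup V] [InnerProductSpace ℂ V] [CompleteSpace V]
  [NormedAddCommGroup G] [InnerProductSpace ℂ G] [CompleteSpace G]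

omit [CompleteSpace V] in
/-- A bounded operator with `∑ ‖T bᵢ‖² < ∞` for a Hilbert basis `b` is compact, as the norm limit
of its restrictions to the spans of finitely many `bᵢ`. -/
lemma isCompactOperator_of_summable_norm_sq (T : V →L[ℂ] G) (b : HilbertBasis ι ℂ V)
    (hT : Summable fun i => ‖T (b i)‖ ^ 2) : IsCompactOperator T := by
  let F : Finset ι → V →L[ℂ] G := fun s =>
    ∑ i ∈ s, (innerSL ℂ (b i)).smulRight (T (b i))
  have hF : ∀ s x, F s x = ∑ i ∈ s, inner ℂ (b i) x • T (b i) := fun s x => by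
    simp [F]
  have hFc : ∀ s, IsCompactOperator (F s) := by
    intro s
    refine Submodule.sum_mem (compactOperator (RingHom.id ℂ) V G) (t := s) fun i _ => ?_
    have h1 : IsCompactOperator (innerSL ℂ (b i)) :=
      isCompactOperator_of_locallyCompactSpace_dom (innerSL ℂ (b i))
    exact h1.clm_comp (ContinuousLinearMap.toSpanSingleton ℂ (T (b i)))
  refine isCompactOperator_of_tendsto (l := atTop) (F := F) ?_ (Eventually.of_forall hFc)
  have hbound : ∀ s : Finset ι,
      ‖F s - T‖ ≤ Real.sqrt (∑' i, ‖T (b i)‖ ^ 2 - ∑ i ∈ s, ‖T (b i)‖ ^ 2) := by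
    intro s
    refine ContinuousLinearMap.opNorm_le_bound _ (Real.sqrt_nonneg _) fun x => ?_
    have hlim : Tendsto (fun t : Finset ι => F s x - F t x) atTop (𝓝 (F s x - T x)) := by
      refine tendsto_const_nhds.sub ?_
      have h1 := (b.hasSum_repr x).mapL T
      refine h1.congr fun t => ?_
      rw [hF]
      exact Finset.sum_congr rfl fun i _ => by simp [b.repr_apply_apply]
    refine le_of_tendsto hlim.norm ?_
    filter_upwards [eventually_ge_atTop s] with t ht
    have ht' : s ⊆ t := ht
    classical
    have h2 : F t x = F s x + ∑ i ∈ t \ s, inner ℂ (b i) x • T (b i) := by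
      rw [hF, hF, add_comm, Finset.sum_sdiff ht']
    rw [h2, sub_add_cancel_left, norm_neg]
    calc ‖∑ i ∈ t \ s, inner ℂ (b i) x • T (b i)‖
        ≤ ∑ i ∈ t \ s, ‖inner ℂ (b i) x‖ * ‖T (b i)‖ := by
          refine (norm_sum_le _ _).trans (Finset.sum_le_sum fun i _ => ?_)
          rw [norm_smul]
      _ ≤ Real.sqrt (∑ i ∈ t \ s, ‖inner ℂ (b i) x‖ ^ 2) *
            Real.sqrt (∑ i ∈ t \ s, ‖T (b i)‖ ^ 2) := Real.sum_mul_le_sqrt_mul_sqrt _ _ _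
      _ ≤ ‖x‖ * Real.sqrt (∑' i, ‖T (b i)‖ ^ 2 - ∑ i ∈ s, ‖T (b i)‖ ^ 2) := by
          refine mul_le_mul ?_ (Real.sqrt_le_sqrt ?_) (Real.sqrt_nonneg _) (norm_nonneg _)
          · exact Real.sqrt_le_iff.mpr ⟨norm_nonneg _, b.orthonormal.sum_inner_products_le x⟩
          · rw [le_sub_iff_add_le, Finset.sum_sdiff ht']
            exact hT.sum_le_tsum _ fun i _ => sq_nonneg _
      _ = _ := mul_comm _ _
  rw [tendsto_iff_norm_sub_tendsto_zero]
  refine squeeze_zero (fun _ => norm_nonneg _) hbound ?_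
  have h1 := (tendsto_const_nhds (x := ∑' i, ‖T (b i)‖ ^ 2)).sub hT.hasSum
  simpa using h1.sqrt

end HilbertSchmidt

/-! ### Multiplication operators and the Fourier coordinate of the Sobolev space -/

section Multiplication

variable {μ : Measure Plane}

/-- A measurable bounded matrix-valued function. -/
def IsMultiplier (μ : Measure Plane) (M : Plane → Spin →L[ℂ] Spin) : Prop :=
  AEStronglyMeasurable M μ ∧ ∃ C, ∀ x, ‖M x‖ ≤ C

lemma IsMultiplier.memLp {M : Plane → Spin →L[ℂ] Spin} (hM : IsMultiplier μ M) (f : SpinL2 μ) :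
    MemLp (fun x => M x (f x)) 2 μ := by
  obtain ⟨hm, C, hC⟩ := hM
  refine (Lp.memLp f).of_le_mul (c := C) ?_ (Eventually.of_forall fun x => ?_)
  · exact isBoundedBilinearMap_apply.continuous.comp_aestronglyMeasurable
      (hm.prodMk (Lp.aestronglyMeasurable f))
  · exact ((M x).le_opNorm _).trans (mul_le_mul_of_nonneg_right (hC x) (norm_nonneg _))

/-- The bounded operator of multiplication by a bounded matrix-valued function. -/
noncomputable def mulOp {M : Plane → Spin →L[ℂ] Spin} (hM : IsMultiplier μ M) :
    SpinL2 μ →L[ℂ] SpinL2 μ :=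
  LinearMap.mkContinuousOfExistsBound
    { toFun := fun f => (hM.memLp f).toLp _
      map_add' := fun f g => by
        rw [← MemLp.toLp_add]
        refine MemLp.toLp_congr _ _ ?_
        filter_upwards [Lp.coeFn_add f g] with x hx
        change M x ((f + g : SpinL2 μ) x) = M x (f x) + M x (g x)
        rw [hx, Pi.add_apply, map_add]
      map_smul' := fun c f => by
        rw [RingHom.id_apply, ← MemLp.toLp_const_smul]
        refine MemLp.toLp_congr _ _ ?_
        filter_upwards [Lp.coeFn_smul c f] with x hx
        change M x ((c • f : SpinL2 μ) x) = c • M x (f x)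
        rw [hx, Pi.smul_apply, map_smul] }
    (by
      obtain ⟨C, hC⟩ := hM.2
      refine ⟨C, fun f => ?_⟩
      refine Lp.norm_le_mul_norm_of_ae_le_mul ?_
      filter_upwards [(hM.memLp f).coeFn_toLp] with x hx
      refine (congrArg norm hx).trans_le ?_
      exact ((M x).le_opNorm _).trans (mul_le_mul_of_nonneg_right (hC x) (norm_nonneg _)))

lemma mulOp_coeFn {M : Plane → Spin →L[ℂ] Spin} (hM : IsMultiplier μ M) (f : SpinL2 μ) :
    mulOp hM f =ᵐ[μ] fun x => M x (f x) :=
  (hM.memLp f).coeFn_toLp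

lemma inner_mulOp {M : Plane → Spin →L[ℂ] Spin} (hM : IsMultiplier μ M) (f g : SpinL2 μ) :
    inner ℂ f (mulOp hM g) = ∫ x, inner ℂ (f x) (M x (g x)) ∂μ := by
  rw [L2.inner_def]
  refine integral_congr_ae ?_
  filter_upwards [mulOp_coeFn hM g] with x hx
  rw [hx]

lemma integrable_inner_mulOp {M : Plane → Spin →L[ℂ] Spin} (hM : IsMultiplier μ M)
    (f g : SpinL2 μ) : Integrable (fun x => inner ℂ (f x) (M x (g x))) μ := by
  refine (L2.integrable_inner f (mulOp hM g)).congr ?_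
  filter_upwards [mulOp_coeFn hM g] with x hx
  rw [hx]

lemma isSelfAdjoint_mulOp {M : Plane → Spin →L[ℂ] Spin} (hM : IsMultiplier μ M)
    (hsa : ∀ x v w, inner ℂ (M x v) w = inner ℂ v (M x w)) : IsSelfAdjoint (mulOp hM) := by
  rw [ContinuousLinearMap.isSelfAdjoint_iff_isSymmetric]
  intro f g
  change inner ℂ (mulOp hM f) g = inner ℂ f (mulOp hM g)
  rw [inner_mulOp, L2.inner_def]
  refine integral_congr_ae ?_
  filter_upwards [mulOp_coeFn hM f] with x hx
  rw [hx, hsa]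

lemma mulOp_comm {M M' : Plane → Spin →L[ℂ] Spin} (hM : IsMultiplier μ M)
    (hM' : IsMultiplier μ M') (h : ∀ x v, M x (M' x v) = M' x (M x v)) (f : SpinL2 μ) :
    mulOp hM (mulOp hM' f) = mulOp hM' (mulOp hM f) := by
  refine Lp.ext ?_
  filter_upwards [mulOp_coeFn hM (mulOp hM' f), mulOp_coeFn hM' (mulOp hM f), mulOp_coeFn hM f,
    mulOp_coeFn hM' f] with x h1 h2 h3 h4
  rw [h1, h2, h3, h4, h]

/-- Multiplication by the value `w x` of a real function. -/
noncomputable def scalarSymbol (w : Plane → ℝ) (x : Plane) : Spin →L[ℂ] Spin :=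
  (w x : ℂ) • 1

lemma scalarSymbol_apply (w : Plane → ℝ) (x : Plane) (v : Spin) :
    scalarSymbol w x v = (w x : ℂ) • v := rfl

lemma isMultiplier_scalarSymbol {w : Plane → ℝ} (hw : Measurable w)
    (hb : ∃ C, ∀ x, |w x| ≤ C) : IsMultiplier μ (scalarSymbol w) := by
  obtain ⟨C, hC⟩ := hb
  refine ⟨?_, C, fun x => ?_⟩
  · exact ((Complex.measurable_ofReal.comp hw).aestronglyMeasurable).smul_const _
  · rw [scalarSymbol, norm_smul, Complex.norm_real, norm_one, mul_one]
    exact hC x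

lemma inner_scalarSymbol_comm (w : Plane → ℝ) (x : Plane) (u v : Spin) :
    inner ℂ (scalarSymbol w x u) v = inner ℂ u (scalarSymbol w x v) := by
  rw [scalarSymbol_apply, scalarSymbol_apply, inner_smul_left, inner_smul_right,
    Complex.conj_ofReal]

lemma inner_scalarSymbol_self (w : Plane → ℝ) (x : Plane) (v : Spin) :
    inner ℂ v (scalarSymbol w x v) = ((w x * ‖v‖ ^ 2 : ℝ) : ℂ) := by
  rw [scalarSymbol_apply, inner_smul_right, inner_self_eq_norm_sq_to_K]
  push_cast
  rfl

lemma inner_mulOp_scalarSymbol {w : Plane → ℝ} (hw : IsMultiplier μ (scalarSymbol w))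
    (f : SpinL2 μ) : inner ℂ f (mulOp hw f) = ((∫ x, w x * ‖f x‖ ^ 2 ∂μ : ℝ) : ℂ) := by
  rw [inner_mulOp]
  simp_rw [inner_scalarSymbol_self]
  exact integral_ofReal

lemma integrable_mul_norm_sq {w : Plane → ℝ} (hw : IsMultiplier μ (scalarSymbol w))
    (f : SpinL2 μ) : Integrable (fun x => w x * ‖f x‖ ^ 2) μ := by
  have := (integrable_inner_mulOp hw f f).re
  simp_rw [inner_scalarSymbol_self] at this
  exact this

lemma norm_sq_eq_integral (f : SpinL2 μ) : ‖f‖ ^ 2 = ∫ x, ‖f x‖ ^ 2 ∂μ := by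
  have h := @inner_self_eq_norm_sq_to_K ℂ _ _ _ _ f
  rw [L2.inner_def] at h
  simp_rw [inner_self_eq_norm_sq_to_K] at h
  have h2 : ∫ x, ((‖f x‖ ^ 2 : ℝ) : ℂ) ∂μ = ((∫ x, ‖f x‖ ^ 2 ∂μ : ℝ) : ℂ) := integral_ofReal
  push_cast at h2
  have h3 := h2.symm.trans h
  have h4 : (((∫ x, ‖f x‖ ^ 2 ∂μ) : ℝ) : ℂ) = ((‖f‖ ^ 2 : ℝ) : ℂ) := by
    rw [h3]; push_cast; rfl
  exact (Complex.ofReal_injective h4).symm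

lemma integrable_norm_sq (f : SpinL2 μ) : Integrable (fun x => ‖f x‖ ^ 2) μ :=
  (memLp_two_iff_integrable_sq_norm (Lp.aestronglyMeasurable f)).mp (Lp.memLp f)

end Multiplication

section SobolevCoordinate

/-- The squared length `|2πξ|²` of the momentum. -/
noncomputable def momentumSq (ξ : Plane) : ℝ := (2 * Real.pi * ‖ξ‖) ^ 2

/-- The weight `(1 + |2πξ|²)^(1/2)` of the Sobolev norm. -/
noncomputable def weight (ξ : Plane) : ℝ := Real.sqrt (1 + momentumSq ξ)

lemma momentumSq_nonneg (ξ : Plane) : 0 ≤ momentumSq ξ := sq_nonneg _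

lemma weight_sq (ξ : Plane) : weight ξ ^ 2 = 1 + momentumSq ξ :=
  Real.sq_sqrt (by linarith [momentumSq_nonneg ξ])

lemma one_le_weight (ξ : Plane) : 1 ≤ weight ξ :=
  Real.one_le_sqrt.mpr (by linarith [momentumSq_nonneg ξ])

lemma weight_pos (ξ : Plane) : 0 < weight ξ := zero_lt_one.trans_le (one_le_weight ξ)

@[fun_prop]
lemma continuous_momentumSq : Continuous momentumSq := by unfold momentumSq; fun_prop

@[fun_prop]
lemma continuous_weight : Continuous weight := by unfold weight; fun_prop

lemma continuous_weight_inv : Continuous fun ξ => (weight ξ)⁻¹ :=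
  continuous_weight.inv₀ fun ξ => (weight_pos ξ).ne'

lemma weight_inv_sq (ξ : Plane) : (weight ξ)⁻¹ ^ 2 = (1 + momentumSq ξ)⁻¹ := by
  rw [inv_pow, weight_sq]

lemma isMultiplier_weight_inv :
    IsMultiplier volume (scalarSymbol fun ξ => (weight ξ)⁻¹) := by
  refine isMultiplier_scalarSymbol continuous_weight_inv.measurable ⟨1, fun ξ => ?_⟩
  rw [abs_of_nonneg (inv_nonneg.mpr (weight_pos ξ).le)]
  exact inv_le_one_of_one_le₀ (one_le_weight ξ)

/-- Division by the weight of the Sobolev norm, in the Fourier picture. -/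
noncomputable def divWeight : Spinors →L[ℂ] Spinors := mulOp isMultiplier_weight_inv

lemma divWeight_coeFn (f : Spinors) :
    divWeight f =ᵐ[volume] fun ξ => (((weight ξ)⁻¹ : ℝ) : ℂ) • f ξ :=
  mulOp_coeFn _ f

/-- The Sobolev spinor with `(1 + |2πξ|²)^(1/2) 𝓕 u = f`, as a bounded map from `L²` to `L²`. -/
noncomputable def sobolevCoord : Spinors →L[ℂ] Spinors :=
  (Lp.fourierTransformₗᵢ Plane Spin).symm.toContinuousLinearEquiv.toContinuousLinearMap ∘L
    divWeight

lemma fourier_sobolevCoord (f : Spinors) : (𝓕 (sobolevCoord f) : Spinors) = divWeight f :=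
  (Lp.fourierTransformₗᵢ Plane Spin).apply_symm_apply _

lemma weightedFourier_eq (u : Spinors) (ξ : Plane) :
    weightedFourier u ξ = weight ξ • (𝓕 u : Spinors) ξ := rfl

lemma weightedFourier_sobolevCoord (f : Spinors) :
    weightedFourier (sobolevCoord f) =ᵐ[volume] f := by
  filter_upwards [divWeight_coeFn f] with ξ hξ
  rw [weightedFourier_eq, fourier_sobolevCoord, hξ, Complex.coe_smul, smul_smul,
    mul_inv_cancel₀ (weight_pos ξ).ne', one_smul]

lemma sobolevCoord_mem (f : Spinors) : sobolevCoord f ∈ sobolev :=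
  (Lp.memLp f).ae_eq (weightedFourier_sobolevCoord f).symm

lemma sobolevWeight_sobolevCoord (f : Spinors) :
    sobolevWeight ⟨sobolevCoord f, sobolevCoord_mem f⟩ = f := by
  refine Lp.ext ?_
  exact (MemLp.coeFn_toLp (sobolev_memLp _)).trans (weightedFourier_sobolevCoord f)

lemma sobolevWeight_bijective : Function.Bijective sobolevWeight :=
  ⟨sobolevWeight_injective, fun f => ⟨_, sobolevWeight_sobolevCoord f⟩⟩

/-- The parametrization of the Sobolev space by `f = (1 + |2πξ|²)^(1/2) 𝓕 u`. -/
noncomputable def sobolevEquiv : Spinors ≃ₗ[ℂ] sobolev :=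
  (LinearEquiv.ofBijective sobolevWeight sobolevWeight_bijective).symm

lemma coe_sobolevEquiv (f : Spinors) : (sobolevEquiv f : Spinors) = sobolevCoord f := by
  have h : sobolevEquiv f = ⟨sobolevCoord f, sobolevCoord_mem f⟩ := by
    rw [sobolevEquiv, LinearEquiv.symm_apply_eq]
    exact (sobolevWeight_sobolevCoord f).symm
  rw [h]

lemma sobolevWeight_sobolevEquiv (f : Spinors) : sobolevWeight (sobolevEquiv f) = f :=
  (LinearEquiv.ofBijective sobolevWeight sobolevWeight_bijective).apply_symm_apply f

lemma sobolevCoord_injective : Function.Injective sobolevCoord := by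
  intro f g h
  refine sobolevEquiv.injective (Subtype.ext ?_)
  rw [coe_sobolevEquiv, coe_sobolevEquiv, h]

lemma inner_sobolevCoord (f v : Spinors) :
    inner ℂ (sobolevCoord f) v = inner ℂ f (divWeight (𝓕 v)) := by
  have hsa : IsSelfAdjoint divWeight := isSelfAdjoint_mulOp _ (inner_scalarSymbol_comm _)
  rw [← Lp.inner_fourier_eq, fourier_sobolevCoord, ← ContinuousLinearMap.adjoint_inner_left,
    hsa.adjoint_eq]

lemma adjoint_sobolevCoord (v : Spinors) :
    ContinuousLinearMap.adjoint sobolevCoord v = divWeight (𝓕 v) := by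
  refine ext_inner_left ℂ fun f => ?_
  rw [ContinuousLinearMap.adjoint_inner_right, inner_sobolevCoord]

lemma divWeight_injective : Function.Injective divWeight := by
  rw [injective_iff_map_eq_zero]
  intro f hf
  refine Lp.ext ?_
  have h := divWeight_coeFn f
  rw [hf] at h
  filter_upwards [h, Lp.coeFn_zero Spin 2 (volume : Measure Plane)] with ξ e1 e2
  rw [e2] at e1 ⊢
  refine (smul_eq_zero.mp e1.symm).resolve_left ?_
  exact_mod_cast inv_ne_zero (weight_pos ξ).ne'

lemma denseRange_sobolevCoord : DenseRange sobolevCoord := by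
  have h : Dense ((sobolevCoord.range : Submodule ℂ Spinors) : Set Spinors) := by
    rw [Submodule.dense_iff_topologicalClosure_eq_top, Submodule.topologicalClosure_eq_top_iff,
      ContinuousLinearMap.orthogonal_range, LinearMap.ker_eq_bot]
    intro v w hvw
    change ContinuousLinearMap.adjoint sobolevCoord v =
      ContinuousLinearMap.adjoint sobolevCoord w at hvw
    rw [adjoint_sobolevCoord, adjoint_sobolevCoord] at hvw
    exact (Lp.fourierTransformₗᵢ Plane Spin).injective (divWeight_injective hvw)
  exact h

lemma norm_sobolevCoord_sq (f : Spinors) :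
    ‖sobolevCoord f‖ ^ 2 = ∫ ξ, (1 + momentumSq ξ)⁻¹ * ‖f ξ‖ ^ 2 := by
  rw [← Lp.norm_fourier_eq, fourier_sobolevCoord, norm_sq_eq_integral]
  refine integral_congr_ae ?_
  filter_upwards [divWeight_coeFn f] with ξ hξ
  rw [hξ, norm_smul, Complex.norm_real, mul_pow, Real.norm_eq_abs, sq_abs, weight_inv_sq]

/-- The isometry from `L²` onto the space `H¹` with its own norm. -/
noncomputable def coordH1 : Spinors →ₗᵢ[ℂ] H1 where
  toLinearMap := toH1.toLinearMap ∘ₗ sobolevEquiv.toLinearMap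
  norm_map' f := by
    change ‖sobolevWeight (sobolevEquiv f)‖ = ‖f‖
    rw [sobolevWeight_sobolevEquiv]

lemma coordH1_apply (f : Spinors) : coordH1 f = toH1 (sobolevEquiv f) := rfl

lemma coordH1_surjective : Function.Surjective coordH1 :=
  toH1.surjective.comp sobolevEquiv.surjective

/-- The Schwartz spinor `φ` is, in `H¹`, the one with coordinate
`(1 + |2πξ|²)^(1/2) 𝓕 φ`. -/
lemma schwartzToH1_eq_coordH1 {φ : 𝓢(Plane, Spin)} {f : Spinors}
    (h : f =ᵐ[volume] fun ξ => weight ξ • 𝓕 φ ξ) : schwartzToH1 φ = coordH1 f := by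
  have hw : weightedFourier (φ.toLp 2) =ᵐ[volume] f := by
    have h1 := SchwartzMap.coeFn_toLp (𝓕 φ) 2 (volume : Measure Plane)
    rw [← SchwartzMap.toLp_fourier_eq] at h1
    filter_upwards [h, h1] with ξ e1 e2
    rw [weightedFourier_eq, e1, e2]
  have h2 : ∀ u : sobolev, (u : Spinors) = φ.toLp 2 → sobolevWeight u = f := by
    intro u hu
    refine Lp.ext ((MemLp.coeFn_toLp (sobolev_memLp u)).trans ?_)
    rw [hu]
    exact hw
  have h3 : sobolevWeight (toH1.symm (schwartzToH1 φ)) = f := h2 _ rfl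
  have h4 : toH1.symm (schwartzToH1 φ) = sobolevEquiv f :=
    sobolevWeight_injective (h3.trans (sobolevWeight_sobolevEquiv f).symm)
  rw [coordH1_apply, ← h4, LinearEquiv.apply_symm_apply]

lemma hasTemperateGrowth_one_add_momentumSq_rpow (r : ℝ) :
    (fun ξ => (1 + momentumSq ξ) ^ r).HasTemperateGrowth := by
  have h1 : (fun ξ : Plane => (1 + ‖ξ‖ ^ 2) ^ r).HasTemperateGrowth :=
    Function.hasTemperateGrowth_one_add_norm_sq_rpow Plane _
  have h2 : (fun ξ : Plane => (2 * Real.pi) • ξ).HasTemperateGrowth :=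
    ((2 * Real.pi) • ContinuousLinearMap.id ℝ Plane).hasTemperateGrowth
  convert h1.comp h2 using 1
  ext ξ
  rw [Function.comp_apply, norm_smul, Real.norm_of_nonneg (by positivity)]
  rfl

lemma hasTemperateGrowth_weight : weight.HasTemperateGrowth := by
  convert hasTemperateGrowth_one_add_momentumSq_rpow (1 / 2) using 1
  ext ξ
  exact Real.sqrt_eq_rpow _

lemma hasTemperateGrowth_weight_inv : (fun ξ => (weight ξ)⁻¹).HasTemperateGrowth := by
  convert hasTemperateGrowth_one_add_momentumSq_rpow (-(1 / 2)) using 1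
  ext ξ
  rw [Real.rpow_neg (by linarith [momentumSq_nonneg ξ]), ← Real.sqrt_eq_rpow]
  rfl

/-- The Schwartz spinor `𝓕⁻ ((1 + |2πξ|²)^(-1/2) ψ)`. -/
noncomputable def besselPotential (ψ : 𝓢(Plane, Spin)) : 𝓢(Plane, Spin) :=
  𝓕⁻ (SchwartzMap.smulLeftCLM Spin (fun ξ => (weight ξ)⁻¹) ψ)

lemma fourier_besselPotential (ψ : 𝓢(Plane, Spin)) (ξ : Plane) :
    𝓕 (besselPotential ψ) ξ = (weight ξ)⁻¹ • ψ ξ := by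
  rw [besselPotential, FourierTransform.fourier_fourierInv_eq,
    SchwartzMap.smulLeftCLM_apply_apply hasTemperateGrowth_weight_inv]

lemma besselPotential_surjective : Function.Surjective besselPotential := by
  intro φ
  refine ⟨SchwartzMap.smulLeftCLM Spin weight (𝓕 φ), ?_⟩
  have h : SchwartzMap.smulLeftCLM Spin (fun ξ => (weight ξ)⁻¹)
      (SchwartzMap.smulLeftCLM Spin weight (𝓕 φ)) = 𝓕 φ := by
    ext1 ξ
    rw [SchwartzMap.smulLeftCLM_apply_apply hasTemperateGrowth_weight_inv,
      SchwartzMap.smulLeftCLM_apply_apply hasTemperateGrowth_weight, smul_smul,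
      inv_mul_cancel₀ (weight_pos ξ).ne', one_smul]
  rw [besselPotential, h, FourierTransform.fourierInv_fourier_eq]

lemma schwartzToH1_besselPotential (ψ : 𝓢(Plane, Spin)) :
    schwartzToH1 (besselPotential ψ) = coordH1 (ψ.toLp 2) := by
  refine schwartzToH1_eq_coordH1 ?_
  filter_upwards [SchwartzMap.coeFn_toLp ψ 2 (volume : Measure Plane)] with ξ hξ
  rw [hξ, fourier_besselPotential, smul_smul, mul_inv_cancel₀ (weight_pos ξ).ne', one_smul]

lemma denseRange_schwartz_toLp :
    DenseRange fun ψ : 𝓢(Plane, Spin) => (ψ.toLp 2 : Spinors) :=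
  SchwartzMap.denseRange_toLpCLM (F := Spin) (p := 2) ENNReal.ofNat_ne_top

lemma denseRange_schwartzToH1 : DenseRange schwartzToH1 := by
  have h1 : DenseRange fun ψ : 𝓢(Plane, Spin) => coordH1 (ψ.toLp 2) :=
    coordH1_surjective.denseRange.comp denseRange_schwartz_toLp coordH1.continuous
  refine h1.mono ?_
  rintro _ ⟨ψ, rfl⟩
  exact ⟨besselPotential ψ, schwartzToH1_besselPotential ψ⟩

end SobolevCoordinate

/-! ### The form bound and the trace on the measure -/

section Plancherel

variable {F : Type*} [NormedAddCommGroup F] [InnerProductSpace ℂ F]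

lemma integrable_norm_sq_schwartz (μ : Measure Plane) [μ.HasTemperateGrowth]
    (φ : 𝓢(Plane, F)) : Integrable (fun x => ‖φ x‖ ^ 2) μ :=
  (memLp_two_iff_integrable_sq_norm φ.continuous.aestronglyMeasurable).mp (φ.memLp 2 μ)

open LineDeriv in
lemma integrable_norm_sq_fderiv (φ : 𝓢(Plane, F)) (v : Plane) :
    Integrable (fun x => ‖fderiv ℝ φ x v‖ ^ 2) := by
  refine (integrable_norm_sq_schwartz volume (∂_{v} φ)).congr (Eventually.of_forall fun x => ?_)
  simp only [SchwartzMap.lineDerivOp_apply_eq_fderiv]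

open LineDeriv in
lemma norm_sq_fourier_lineDeriv (φ : 𝓢(Plane, F)) (i : Fin 2) (ξ : Plane) :
    ‖𝓕 (∂_{(EuclideanSpace.single i 1 : Plane)} φ) ξ‖ ^ 2 =
      (2 * Real.pi) ^ 2 * ξ i ^ 2 * ‖𝓕 φ ξ‖ ^ 2 := by
  have hg : (inner ℝ · (EuclideanSpace.single i 1 : Plane)).HasTemperateGrowth := by fun_prop
  rw [SchwartzMap.fourier_lineDerivOp_eq, smul_apply,
    SchwartzMap.smulLeftCLM_apply_apply hg, norm_smul, norm_smul, mul_pow, mul_pow]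
  simp [EuclideanSpace.inner_single_right, mul_assoc, abs_of_pos Real.pi_pos]

lemma momentumSq_eq_sum (ξ : Plane) :
    momentumSq ξ = ∑ i : Fin 2, (2 * Real.pi) ^ 2 * ξ i ^ 2 := by
  rw [momentumSq, mul_pow, EuclideanSpace.real_norm_sq_eq, Finset.mul_sum]

open LineDeriv in
/-- The identity `∫ |∇φ|² = ∫ |2πξ|² |𝓕 φ|²` for Schwartz functions. -/
lemma integral_norm_sq_gradient [CompleteSpace F] (φ : 𝓢(Plane, F)) :
    ∫ x, ∑ i : Fin 2, ‖fderiv ℝ φ x (EuclideanSpace.single i 1)‖ ^ 2 =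
      ∫ ξ, momentumSq ξ * ‖𝓕 φ ξ‖ ^ 2 := by
  simp_rw [momentumSq_eq_sum, Finset.sum_mul, ← norm_sq_fourier_lineDeriv]
  rw [integral_finsetSum _ fun i _ => integrable_norm_sq_fderiv φ _,
    integral_finsetSum _ fun i _ => integrable_norm_sq_schwartz volume _]
  refine Finset.sum_congr rfl fun i _ => ?_
  rw [SchwartzMap.integral_norm_sq_fourier]
  simp only [SchwartzMap.lineDerivOp_apply_eq_fderiv]

lemma integrable_momentumSq_mul (φ : 𝓢(Plane, F)) :
    Integrable fun ξ => momentumSq ξ * ‖𝓕 φ ξ‖ ^ 2 := by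
  simp_rw [momentumSq_eq_sum, Finset.sum_mul, ← norm_sq_fourier_lineDeriv]
  exact integrable_finsetSum _ fun i _ => integrable_norm_sq_schwartz volume _

end Plancherel

section FormBound

variable {m : Measure Plane} [IsFiniteMeasure m] {h : Plane → ℝ} {a b : ℝ}

omit [IsFiniteMeasure m] in
lemma integrable_one_add_sq_mul (hmeas : Measurable h) (hbdd : ∃ C : ℝ, ∀ x, |h x| ≤ C)
    {g : Plane → ℝ} (hg : Integrable g m) : Integrable (fun x => (1 + h x ^ 2) * g x) m := by
  obtain ⟨C, hC⟩ := hbdd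
  refine hg.bdd_mul (c := 1 + C ^ 2) (by fun_prop) (Eventually.of_forall fun x => ?_)
  rw [Real.norm_of_nonneg (by positivity)]
  have := sq_le_sq' (neg_le_of_abs_le (hC x)) (le_of_abs_le (hC x))
  linarith

/-- The form bound for scalar functions implies the one for spinors, component by component. -/
lemma FormBound.schwartz_spinor (hab : FormBound m h a b) (hmeas : Measurable h)
    (hbdd : ∃ C : ℝ, ∀ x, |h x| ≤ C) (φ : 𝓢(Plane, Spin)) :
    ∫ x, (1 + h x ^ 2) * ‖φ x‖ ^ 2 ∂m ≤
      a * (∫ ξ, momentumSq ξ * ‖𝓕 φ ξ‖ ^ 2) + b * (∫ ξ, ‖𝓕 φ ξ‖ ^ 2) := by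
  let φc : Fin 2 → 𝓢(Plane, ℂ) := fun j =>
    φ.postcompCLM (EuclideanSpace.proj j : Spin →L[ℂ] ℂ)
  have hφc : ∀ j x, φc j x = φ x j := fun j x => rfl
  have hfd : ∀ j x (v : Plane), fderiv ℝ (φc j) x v = fderiv ℝ φ x v j := by
    intro j x v
    have h1 : HasFDerivAt (φc j) (((EuclideanSpace.proj j : Spin →L[ℂ] ℂ).restrictScalars ℝ).comp
        (fderiv ℝ φ x)) x :=
      ((EuclideanSpace.proj j : Spin →L[ℂ] ℂ).restrictScalars ℝ).hasFDerivAt.comp x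
        φ.differentiableAt.hasFDerivAt
    rw [h1.fderiv]
    rfl
  have hsum : ∀ v : Spin, ‖v‖ ^ 2 = ∑ j, ‖v j‖ ^ 2 := EuclideanSpace.norm_sq_eq
  rw [← integral_norm_sq_gradient, SchwartzMap.integral_norm_sq_fourier]
  have e1 : ∫ x, (1 + h x ^ 2) * ‖φ x‖ ^ 2 ∂m =
      ∑ j, ∫ x, (1 + h x ^ 2) * ‖φc j x‖ ^ 2 ∂m := by
    simp_rw [hsum, Finset.mul_sum, ← hφc]
    exact integral_finsetSum _ fun j _ =>
      integrable_one_add_sq_mul hmeas hbdd (integrable_norm_sq_schwartz m _)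
  have e2 : ∫ x, ∑ i : Fin 2, ‖fderiv ℝ φ x (EuclideanSpace.single i 1)‖ ^ 2 =
      ∑ j, ∫ x, ∑ i : Fin 2, ‖fderiv ℝ (φc j) x (EuclideanSpace.single i 1)‖ ^ 2 := by
    simp_rw [hsum, ← hfd]
    rw [← integral_finsetSum _ fun j _ =>
      integrable_finsetSum _ fun i _ => integrable_norm_sq_fderiv (φc j) _]
    refine integral_congr_ae (Eventually.of_forall fun x => ?_)
    exact Finset.sum_comm
  have e3 : ∫ x, ‖φ x‖ ^ 2 = ∑ j, ∫ x, ‖φc j x‖ ^ 2 := by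
    simp_rw [hsum, ← hφc]
    exact integral_finsetSum _ fun j _ => integrable_norm_sq_schwartz volume _
  rw [e1, e2, e3, Finset.mul_sum, Finset.mul_sum, ← Finset.sum_add_distrib]
  exact Finset.sum_le_sum fun j _ => hab (φc j)

/-- The Fourier multiplier `(a |2πξ|² + b) / (1 + |2πξ|²)`: the right-hand side of the form bound
in the coordinate of the Sobolev space. -/
noncomputable def boundRatio (a b : ℝ) (ξ : Plane) : ℝ :=
  (a * momentumSq ξ + b) * (1 + momentumSq ξ)⁻¹

lemma abs_boundRatio_le (a b : ℝ) (ξ : Plane) : |boundRatio a b ξ| ≤ |a| + |b| := by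
  have h0 := momentumSq_nonneg ξ
  rw [boundRatio, abs_mul, abs_inv, abs_of_pos (by linarith : 0 < 1 + momentumSq ξ),
    ← div_eq_mul_inv, div_le_iff₀ (by linarith)]
  refine (abs_add_le _ _).trans ?_
  rw [abs_mul, abs_of_nonneg h0]
  nlinarith [abs_nonneg a, abs_nonneg b, mul_nonneg (abs_nonneg b) h0]

lemma isMultiplier_boundRatio (a b : ℝ) :
    IsMultiplier volume (scalarSymbol (boundRatio a b)) := by
  refine isMultiplier_scalarSymbol ?_ ⟨_, abs_boundRatio_le a b⟩
  have := continuous_momentumSq.measurable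
  unfold boundRatio
  fun_prop

lemma FormBound.integral_besselPotential_le (hab : FormBound m h a b) (hmeas : Measurable h)
    (hbdd : ∃ C : ℝ, ∀ x, |h x| ≤ C) (ψ : 𝓢(Plane, Spin)) :
    ∫ x, (1 + h x ^ 2) * ‖besselPotential ψ x‖ ^ 2 ∂m ≤ ∫ ξ, boundRatio a b ξ * ‖ψ ξ‖ ^ 2 := by
  refine (hab.schwartz_spinor hmeas hbdd _).trans_eq ?_
  rw [← integral_const_mul, ← integral_const_mul,
    ← integral_add ((integrable_momentumSq_mul _).const_mul a)
      ((integrable_norm_sq_schwartz volume _).const_mul b)]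
  refine integral_congr_ae (Eventually.of_forall fun ξ => ?_)
  simp only [fourier_besselPotential, norm_smul, mul_pow]
  rw [Real.norm_eq_abs, sq_abs, weight_inv_sq, boundRatio]
  ring

lemma norm_sq_toLp_eq (μ : Measure Plane) [μ.HasTemperateGrowth] (φ : 𝓢(Plane, Spin)) :
    ‖φ.toLp 2 μ‖ ^ 2 = ∫ x, ‖φ x‖ ^ 2 ∂μ := by
  rw [norm_sq_eq_integral]
  refine integral_congr_ae ?_
  filter_upwards [SchwartzMap.coeFn_toLp φ 2 μ] with x hx
  rw [hx]

lemma FormBound.exists_norm_toLp_le (hab : FormBound m h a b) (hmeas : Measurable h)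
    (hbdd : ∃ C : ℝ, ∀ x, |h x| ≤ C) :
    ∃ C, ∀ φ : 𝓢(Plane, Spin), ‖φ.toLp 2 m‖ ≤ C * ‖schwartzToH1 φ‖ := by
  refine ⟨Real.sqrt (|a| + |b|), fun φ => ?_⟩
  obtain ⟨ψ, rfl⟩ := besselPotential_surjective φ
  rw [schwartzToH1_besselPotential, LinearIsometry.norm_map]
  refine (pow_le_pow_iff_left₀ (norm_nonneg _) (by positivity) two_ne_zero).mp ?_
  rw [mul_pow, Real.sq_sqrt (by positivity), norm_sq_toLp_eq, norm_sq_toLp_eq]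
  have hi := integrable_norm_sq_schwartz m (besselPotential ψ)
  have hv := integrable_norm_sq_schwartz volume ψ
  calc ∫ x, ‖besselPotential ψ x‖ ^ 2 ∂m
      ≤ ∫ x, (1 + h x ^ 2) * ‖besselPotential ψ x‖ ^ 2 ∂m := by
        refine integral_mono hi (integrable_one_add_sq_mul hmeas hbdd hi) fun x => ?_
        nlinarith [mul_nonneg (sq_nonneg (h x)) (sq_nonneg ‖besselPotential ψ x‖)]
    _ ≤ ∫ ξ, boundRatio a b ξ * ‖ψ ξ‖ ^ 2 := hab.integral_besselPotential_le hmeas hbdd ψ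
    _ ≤ ∫ ξ, (|a| + |b|) * ‖ψ ξ‖ ^ 2 := by
        refine integral_mono ?_ (hv.const_mul _) fun ξ => ?_
        · refine (integrable_mul_norm_sq (isMultiplier_boundRatio a b) (ψ.toLp 2)).congr ?_
          filter_upwards [SchwartzMap.coeFn_toLp ψ 2 (volume : Measure Plane)] with ξ hξ
          rw [hξ]
        · exact mul_le_mul_of_nonneg_right (le_of_abs_le (abs_boundRatio_le a b ξ))
            (sq_nonneg _)
    _ = (|a| + |b|) * ∫ ξ, ‖ψ ξ‖ ^ 2 := integral_const_mul _ _

/-- The map `J₂` in the coordinate of the Sobolev space. -/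
noncomputable def traceCoord (m : Measure Plane) [IsFiniteMeasure m] : Spinors →L[ℂ] SpinL2 m :=
  J2 m ∘L coordH1.toContinuousLinearMap

lemma traceCoord_apply (f : Spinors) : traceCoord m f = J2 m (toH1 (sobolevEquiv f)) := rfl

lemma FormBound.traceCoord_toLp (hab : FormBound m h a b) (hmeas : Measurable h)
    (hbdd : ∃ C : ℝ, ∀ x, |h x| ≤ C) (ψ : 𝓢(Plane, Spin)) :
    traceCoord m (ψ.toLp 2) = (besselPotential ψ).toLp 2 m := by
  change J2 m (coordH1 (ψ.toLp 2)) = _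
  rw [← schwartzToH1_besselPotential]
  exact LinearMap.extendOfNorm_eq denseRange_schwartzToH1
    (hab.exists_norm_toLp_le hmeas hbdd) (besselPotential ψ)

omit [IsFiniteMeasure m] in
lemma isMultiplier_one_add_sq (hmeas : Measurable h) (hbdd : ∃ C : ℝ, ∀ x, |h x| ≤ C) :
    IsMultiplier m (scalarSymbol fun x => 1 + h x ^ 2) := by
  obtain ⟨C, hC⟩ := hbdd
  refine isMultiplier_scalarSymbol (by fun_prop) ⟨1 + C ^ 2, fun x => ?_⟩
  rw [abs_of_nonneg (by positivity)]
  have := sq_le_sq' (neg_le_of_abs_le (hC x)) (le_of_abs_le (hC x))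
  linarith

/-- The form bound extends from Schwartz spinors to the Sobolev space. -/
lemma FormBound.integral_traceCoord_le (hab : FormBound m h a b) (hmeas : Measurable h)
    (hbdd : ∃ C : ℝ, ∀ x, |h x| ≤ C) (f : Spinors) :
    ∫ x, (1 + h x ^ 2) * ‖traceCoord m f x‖ ^ 2 ∂m ≤ ∫ ξ, boundRatio a b ξ * ‖f ξ‖ ^ 2 := by
  have hM := isMultiplier_one_add_sq (m := m) hmeas hbdd
  have hP := isMultiplier_boundRatio a b
  suffices H : (inner ℂ (traceCoord m f) (mulOp hM (traceCoord m f))).re ≤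
      (inner ℂ f (mulOp hP f)).re by
    rwa [inner_mulOp_scalarSymbol, inner_mulOp_scalarSymbol, Complex.ofReal_re,
      Complex.ofReal_re] at H
  refine denseRange_schwartz_toLp.induction_on
    (p := fun f => (inner ℂ (traceCoord m f) (mulOp hM (traceCoord m f))).re ≤
      (inner ℂ f (mulOp hP f)).re) f ?_ fun ψ => ?_
  · refine isClosed_le ?_ ?_
    · fun_prop
    · fun_prop
  · rw [inner_mulOp_scalarSymbol, inner_mulOp_scalarSymbol, Complex.ofReal_re,
      Complex.ofReal_re, hab.traceCoord_toLp hmeas hbdd]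
    have h1 : ∫ x, (1 + h x ^ 2) * ‖(besselPotential ψ).toLp 2 m x‖ ^ 2 ∂m =
        ∫ x, (1 + h x ^ 2) * ‖besselPotential ψ x‖ ^ 2 ∂m := by
      refine integral_congr_ae ?_
      filter_upwards [SchwartzMap.coeFn_toLp (besselPotential ψ) 2 m] with x hx
      rw [hx]
    have h2 : ∫ ξ, boundRatio a b ξ * ‖(ψ.toLp 2 : Spinors) ξ‖ ^ 2 =
        ∫ ξ, boundRatio a b ξ * ‖ψ ξ‖ ^ 2 := by
      refine integral_congr_ae ?_
      filter_upwards [SchwartzMap.coeFn_toLp ψ 2 (volume : Measure Plane)] with x hx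
      rw [hx]
    rw [h1, h2]
    exact hab.integral_besselPotential_le hmeas hbdd ψ

end FormBound

/-! ### Compactness of the trace on `H²` -/

section Compactness

/-- The function `ξ ↦ e^(-2πi⟨ξ, x⟩) / (1 + |2πξ|²)` in the `j`-th spin direction. Pairing with it
evaluates the `j`-th component of `𝓕⁻ (g / (1 + |2πξ|²))` at the point `x`. -/
noncomputable def evalKernel (x : Plane) (j : Fin 2) (ξ : Plane) : Spin :=
  (((1 + momentumSq ξ)⁻¹ : ℝ) * Complex.exp (-((2 * Real.pi * inner ℝ ξ x : ℝ) * Complex.I))) •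
    EuclideanSpace.single j 1

lemma norm_evalKernel_sq (x : Plane) (j : Fin 2) (ξ : Plane) :
    ‖evalKernel x j ξ‖ ^ 2 = (1 + momentumSq ξ)⁻¹ ^ 2 := by
  have h := Complex.norm_exp_ofReal_mul_I (-(2 * Real.pi * inner ℝ ξ x))
  rw [Complex.ofReal_neg, neg_mul] at h
  rw [evalKernel, norm_smul, norm_mul, h, Complex.norm_real]
  simp

lemma continuous_inv_one_add_momentumSq : Continuous fun ξ => (1 + momentumSq ξ)⁻¹ := by
  refine Continuous.inv₀ (by fun_prop) fun ξ => ?_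
  linarith [momentumSq_nonneg ξ]

lemma integrable_inv_one_add_momentumSq_sq :
    Integrable fun ξ : Plane => (1 + momentumSq ξ)⁻¹ ^ 2 := by
  have h1 : Integrable fun ξ : Plane => (1 + ‖ξ‖ ^ 2) ^ (-(4 : ℝ) / 2) :=
    integrable_rpow_neg_one_add_norm_sq (by simp; norm_num)
  refine h1.mono' (continuous_inv_one_add_momentumSq.pow 2).aestronglyMeasurable
    (Eventually.of_forall fun ξ => ?_)
  have h2 : (1 + ‖ξ‖ ^ 2) ^ (-(4 : ℝ) / 2) = (1 + ‖ξ‖ ^ 2)⁻¹ ^ 2 := by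
    rw [show (-(4 : ℝ) / 2) = -((2 : ℕ) : ℝ) by norm_num, Real.rpow_neg (by positivity),
      Real.rpow_natCast, inv_pow]
  rw [h2, Real.norm_of_nonneg (sq_nonneg _)]
  have h3 : ‖ξ‖ ^ 2 ≤ momentumSq ξ := by
    refine pow_le_pow_left₀ (norm_nonneg ξ) ?_ 2
    exact le_mul_of_one_le_left (norm_nonneg ξ) (by linarith [Real.pi_gt_three])
  have h4 := inv_anti₀ (by positivity) (by linarith : 1 + ‖ξ‖ ^ 2 ≤ 1 + momentumSq ξ)
  exact pow_le_pow_left₀ (inv_nonneg.mpr (by linarith [momentumSq_nonneg ξ])) h4 2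

lemma memLp_evalKernel (x : Plane) (j : Fin 2) : MemLp (evalKernel x j) 2 volume := by
  have hc : Continuous (evalKernel x j) := by
    have h1 := continuous_inv_one_add_momentumSq
    unfold evalKernel
    fun_prop
  rw [memLp_two_iff_integrable_sq_norm hc.aestronglyMeasurable]
  simp_rw [norm_evalKernel_sq]
  exact integrable_inv_one_add_momentumSq_sq

/-- `evalKernel` as an element of `L²`. -/
noncomputable def evalVector (x : Plane) (j : Fin 2) : Spinors := (memLp_evalKernel x j).toLp _

lemma norm_evalVector_sq (x : Plane) (j : Fin 2) :
    ‖evalVector x j‖ ^ 2 = ∫ ξ, (1 + momentumSq ξ)⁻¹ ^ 2 := by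
  rw [norm_sq_eq_integral]
  refine integral_congr_ae ?_
  filter_upwards [(memLp_evalKernel x j).coeFn_toLp] with ξ hξ
  rw [evalVector, hξ, norm_evalKernel_sq]

lemma inner_evalKernel (x : Plane) (j : Fin 2) (ξ : Plane) (v : Spin) :
    inner ℂ (evalKernel x j ξ) v =
      (Complex.exp ((2 * Real.pi * inner ℝ ξ x : ℝ) * Complex.I) •
        ((weight ξ)⁻¹ • (weight ξ)⁻¹ • v)) j := by
  rw [evalKernel, inner_smul_left, EuclideanSpace.inner_single_left, map_mul, Complex.conj_ofReal,
    ← Complex.exp_conj, map_neg, map_mul, Complex.conj_ofReal, Complex.conj_I, smul_smul,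
    ← sq, weight_inv_sq]
  simp
  ring

lemma inner_evalVector_schwartz (x : Plane) (j : Fin 2) (ψ : 𝓢(Plane, Spin)) :
    inner ℂ (evalVector x j) (ψ.toLp 2 : Spinors) =
      besselPotential (SchwartzMap.smulLeftCLM Spin (fun ξ => (weight ξ)⁻¹) ψ) x j := by
  set χ := SchwartzMap.smulLeftCLM Spin (fun ξ => (weight ξ)⁻¹)
    (SchwartzMap.smulLeftCLM Spin (fun ξ => (weight ξ)⁻¹) ψ) with hχ
  have hχ' : ∀ ξ, χ ξ = (weight ξ)⁻¹ • (weight ξ)⁻¹ • ψ ξ := fun ξ => by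
    rw [hχ, SchwartzMap.smulLeftCLM_apply_apply hasTemperateGrowth_weight_inv,
      SchwartzMap.smulLeftCLM_apply_apply hasTemperateGrowth_weight_inv]
  have hint : Integrable fun ξ : Plane =>
      Complex.exp ((2 * Real.pi * inner ℝ ξ x : ℝ) * Complex.I) • χ ξ := by
    refine χ.integrable.mono ?_ (Eventually.of_forall fun ξ => ?_)
    · exact Continuous.aestronglyMeasurable (by fun_prop)
    · rw [norm_smul, Complex.norm_exp_ofReal_mul_I, one_mul]
  have h1 : besselPotential (SchwartzMap.smulLeftCLM Spin (fun ξ => (weight ξ)⁻¹) ψ) x =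
      ∫ ξ, Complex.exp ((2 * Real.pi * inner ℝ ξ x : ℝ) * Complex.I) • χ ξ := by
    rw [besselPotential, ← hχ, SchwartzMap.fourierInv_coe, Real.fourierInv_eq']
  have h2 := (EuclideanSpace.proj j : Spin →L[ℂ] ℂ).integral_comp_comm hint
  rw [h1]
  refine Eq.trans ?_ h2
  rw [L2.inner_def]
  refine integral_congr_ae ?_
  filter_upwards [(memLp_evalKernel x j).coeFn_toLp,
    SchwartzMap.coeFn_toLp ψ 2 (volume : Measure Plane)] with ξ e1 e2
  rw [evalVector, e1, e2, inner_evalKernel, hχ']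
  rfl

lemma divWeight_schwartz (ψ : 𝓢(Plane, Spin)) :
    divWeight (ψ.toLp 2) =
      (SchwartzMap.smulLeftCLM Spin (fun ξ => (weight ξ)⁻¹) ψ).toLp 2 := by
  refine Lp.ext ?_
  filter_upwards [divWeight_coeFn (ψ.toLp 2), SchwartzMap.coeFn_toLp ψ 2 (volume : Measure Plane),
    SchwartzMap.coeFn_toLp (SchwartzMap.smulLeftCLM Spin (fun ξ => (weight ξ)⁻¹) ψ) 2
      (volume : Measure Plane)] with ξ e1 e2 e3
  rw [e1, e2, e3, SchwartzMap.smulLeftCLM_apply_apply hasTemperateGrowth_weight_inv,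
    Complex.coe_smul]

variable {m : Measure Plane} [IsFiniteMeasure m] {h : Plane → ℝ} {a b : ℝ}

/-- Elements of `H²` are functions: the trace on `m` of `𝓕⁻ (g / (1 + |2πξ|²))` has the
pointwise values given by the absolutely convergent Fourier integral. -/
lemma FormBound.trace_divWeight_coeFn (hab : FormBound m h a b) (hmeas : Measurable h)
    (hbdd : ∃ C : ℝ, ∀ x, |h x| ≤ C) (g : Spinors) :
    ∀ᵐ x ∂m, ∀ j, traceCoord m (divWeight g) x j = inner ℂ (evalVector x j) g := by
  -- both sides depend continuously on `g`, and they agree for Schwartz spinors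
  obtain ⟨u, hu⟩ := mem_closure_iff_seq_limit.mp (denseRange_schwartz_toLp g)
  obtain ⟨hu1, hu2⟩ := hu
  choose ψ hψ using hu1
  obtain rfl : u = fun n => ((ψ n).toLp 2 : Spinors) := funext fun n => (hψ n).symm
  have hlim : Tendsto (fun n => traceCoord m (divWeight ((ψ n).toLp 2))) atTop
      (𝓝 (traceCoord m (divWeight g))) :=
    ((traceCoord m ∘L divWeight).continuous.tendsto g).comp hu2
  obtain ⟨ns, hns, hae⟩ := (tendstoInMeasure_of_tendsto_Lp hlim).exists_seq_tendsto_ae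
  have hval : ∀ᵐ x ∂m, ∀ n, traceCoord m (divWeight ((ψ n).toLp 2)) x =
      besselPotential (SchwartzMap.smulLeftCLM Spin (fun ξ => (weight ξ)⁻¹) (ψ n)) x := by
    rw [ae_all_iff]
    intro n
    rw [divWeight_schwartz, hab.traceCoord_toLp hmeas hbdd]
    exact SchwartzMap.coeFn_toLp _ 2 m
  filter_upwards [hae, hval] with x h1 h2 j
  have h3 : Tendsto (fun i => inner ℂ (evalVector x j) ((ψ (ns i)).toLp 2 : Spinors)) atTop
      (𝓝 (traceCoord m (divWeight g) x j)) := by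
    have h4 := ((EuclideanSpace.proj j : Spin →L[ℂ] ℂ).continuous.tendsto _).comp h1
    refine h4.congr fun i => ?_
    rw [inner_evalVector_schwartz, ← h2]
    rfl
  exact tendsto_nhds_unique h3 
    (((innerSL ℂ (evalVector x j)).continuous.tendsto g).comp (hu2.comp hns.tendsto_atTop))

/-- The trace map from `H²` to `L²(m)` is Hilbert-Schmidt, hence compact: `m` is finite and
`(1 + |2πξ|²)⁻¹` is square-integrable on the plane. -/
lemma FormBound.isCompactOperator_trace_divWeight (hab : FormBound m h a b)
    (hmeas : Measurable h) (hbdd : ∃ C : ℝ, ∀ x, |h x| ≤ C) :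
    IsCompactOperator (traceCoord m ∘L divWeight) := by
  obtain ⟨w, e, -⟩ := exists_hilbertBasis ℂ Spinors
  refine isCompactOperator_of_summable_norm_sq _ e ?_
  -- Bessel's inequality at each point `x` bounds the partial sums uniformly
  refine summable_of_sum_le (c := ∫ _ : Plane, 2 * (∫ ξ, (1 + momentumSq ξ)⁻¹ ^ 2) ∂m)
    (fun i => sq_nonneg _) fun s => ?_
  simp_rw [ContinuousLinearMap.comp_apply, norm_sq_eq_integral]
  rw [← integral_finsetSum _ fun i _ => integrable_norm_sq _]
  refine integral_mono_ae (integrable_finsetSum _ fun i _ => integrable_norm_sq _)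
    (integrable_const _) ?_
  have hall : ∀ᵐ x ∂m, ∀ i ∈ s, ∀ j, traceCoord m (divWeight (e i)) x j =
      inner ℂ (evalVector x j) (e i) :=
    (ae_ball_iff s.countable_toSet).mpr fun i _ => hab.trace_divWeight_coeFn hmeas hbdd (e i)
  filter_upwards [hall] with x hx
  calc ∑ i ∈ s, ‖traceCoord m (divWeight (e i)) x‖ ^ 2
      = ∑ i ∈ s, ∑ j, ‖inner ℂ (e i) (evalVector x j)‖ ^ 2 := by
        refine Finset.sum_congr rfl fun i hi => ?_
        rw [EuclideanSpace.norm_sq_eq]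
        refine Finset.sum_congr rfl fun j _ => ?_
        rw [hx i hi, norm_inner_symm]
    _ = ∑ j, ∑ i ∈ s, ‖inner ℂ (e i) (evalVector x j)‖ ^ 2 := Finset.sum_comm
    _ ≤ ∑ j : Fin 2, ‖evalVector x j‖ ^ 2 :=
        Finset.sum_le_sum fun j _ => e.orthonormal.sum_inner_products_le _
    _ = 2 * ∫ ξ, (1 + momentumSq ξ)⁻¹ ^ 2 := by
        simp_rw [norm_evalVector_sq]
        simp

end Compactness

/-! ### The form of the unperturbed Hamiltonian -/

section Symbol

/-- The matrix `Ĥ₀(2πξ)` as an operator on spinor values. -/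
noncomputable def symbolCLM (A : Plane → ℂ) (ξ : Plane) : Spin →L[ℂ] Spin :=
  Matrix.toEuclideanCLM (𝕜 := ℂ) (symbol A ((2 * Real.pi) • ξ))

variable {A : Plane → ℂ}

lemma symbolFourier_eq (u : Spinors) (ξ : Plane) :
    symbolFourier A u ξ = symbolCLM A ξ ((𝓕 u : Spinors) ξ) := rfl

lemma norm_smul_sq_eq_momentumSq (ξ : Plane) : ‖(2 * Real.pi) • ξ‖ ^ 2 = momentumSq ξ := by
  rw [norm_smul, Real.norm_of_nonneg (by positivity)]
  rfl

lemma inner_symbolCLM_comm (ξ : Plane) (v w : Spin) :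
    inner ℂ (symbolCLM A ξ v) w = inner ℂ v (symbolCLM A ξ w) := by
  have hherm : star (symbol A ((2 * Real.pi) • ξ)) = symbol A ((2 * Real.pi) • ξ) := by
    ext i j
    fin_cases i <;> fin_cases j <;> simp [symbol, Matrix.star_apply]
  have hsa : IsSelfAdjoint (symbolCLM A ξ) := by
    rw [IsSelfAdjoint, symbolCLM, ← map_star, hherm]
  rw [← ContinuousLinearMap.adjoint_inner_right, hsa.adjoint_eq]

/-- The diagonal part of `Ĥ₀` is `|p|²`, and its off-diagonal part scales norms by `|A(p)|`. -/
lemma exists_symbolCLM_eq (ξ : Plane) (v : Spin) :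
    ∃ w : Spin, symbolCLM A ξ v = (momentumSq ξ : ℂ) • v + w ∧
      ‖w‖ = ‖A ((2 * Real.pi) • ξ)‖ * ‖v‖ := by
  refine ⟨!₂[A ((2 * Real.pi) • ξ) * v 1, conj (A ((2 * Real.pi) • ξ)) * v 0], ?_, ?_⟩
  · ext i
    change (symbol A ((2 * Real.pi) • ξ)).mulVec v.ofLp i = _
    rw [symbol, norm_smul_sq_eq_momentumSq]
    fin_cases i <;> simp [Matrix.mulVec, dotProduct, Fin.sum_univ_two, add_comm]
  · refine (pow_left_inj₀ (norm_nonneg _) (by positivity) two_ne_zero).mp ?_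
    rw [EuclideanSpace.norm_sq_eq, mul_pow, EuclideanSpace.norm_sq_eq v]
    simp [Fin.sum_univ_two, mul_pow]
    ring

lemma norm_symbolCLM_apply_le (ξ : Plane) (v : Spin) :
    ‖symbolCLM A ξ v‖ ≤ (momentumSq ξ + ‖A ((2 * Real.pi) • ξ)‖) * ‖v‖ := by
  obtain ⟨w, h1, h2⟩ := exists_symbolCLM_eq (A := A) ξ v
  rw [h1, add_mul, ← h2]
  refine (norm_add_le _ _).trans_eq ?_
  rw [norm_smul, Complex.norm_real, Real.norm_of_nonneg (momentumSq_nonneg ξ)]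

lemma le_re_inner_symbolCLM (ξ : Plane) (v : Spin) :
    (momentumSq ξ - ‖A ((2 * Real.pi) • ξ)‖) * ‖v‖ ^ 2 ≤ (inner ℂ v (symbolCLM A ξ v)).re := by
  obtain ⟨w, h1, h2⟩ := exists_symbolCLM_eq (A := A) ξ v
  have h3 : |(inner ℂ v w).re| ≤ ‖v‖ * ‖w‖ :=
    (Complex.abs_re_le_norm _).trans (norm_inner_le_norm v w)
  have h4 : (inner ℂ v ((momentumSq ξ : ℂ) • v)).re = momentumSq ξ * ‖v‖ ^ 2 := by
    have := inner_scalarSymbol_self momentumSq ξ v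
    rw [scalarSymbol_apply] at this
    rw [this, Complex.ofReal_re]
  rw [h1, inner_add_right, Complex.add_re, h4]
  rw [h2] at h3
  nlinarith [neg_le_of_abs_le h3]

lemma continuous_symbolCLM (hA : Continuous A) : Continuous (symbolCLM A) := by
  have h1 : Continuous fun ξ : Plane => symbol A ((2 * Real.pi) • ξ) := by
    refine continuous_matrix fun i j => ?_
    fin_cases i <;> fin_cases j <;> simp [symbol] <;> fun_prop
  have h2 : Continuous (Matrix.toEuclideanCLM (𝕜 := ℂ) :
      Matrix (Fin 2) (Fin 2) ℂ → Spin →L[ℂ] Spin) :=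
    LinearMap.continuous_of_finiteDimensional
      (Matrix.toEuclideanCLM (n := Fin 2) (𝕜 := ℂ)).toAlgEquiv.toLinearMap
  exact h2.comp h1

/-- The limit superior of `|A(p)| / |p|²` controls `A` globally, up to a constant, by continuity
of `A` on compact sets. -/
lemma exists_norm_le_of_limsupRatio (hA : Continuous A) {s : ℝ} (hs : 0 ≤ s)
    (hlim : limsupRatio A + ENNReal.ofReal s < 1) :
    ∃ c C : ℝ, 0 < c ∧ 0 ≤ C ∧ ∀ p, ‖A p‖ ≤ (1 - s - c) * ‖p‖ ^ 2 + C := by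
  have h1 : limsupRatio A < 1 - ENNReal.ofReal s := lt_tsub_iff_right.mpr hlim
  obtain ⟨t, ht1, ht2⟩ := exists_between h1
  have ht3 : t + ENNReal.ofReal s < 1 := lt_tsub_iff_right.mp ht2
  have htop : t ≠ ⊤ := ne_top_of_lt ht2
  have ht4 : t.toReal + s < 1 := by
    have := (ENNReal.toReal_lt_toReal (by finiteness) ENNReal.one_ne_top).mpr ht3
    rwa [ENNReal.toReal_add htop ENNReal.ofReal_ne_top, ENNReal.toReal_ofReal hs,
      ENNReal.toReal_one] at this
  have hev : ∀ᶠ p in cocompact Plane, ‖A p‖ ≤ t.toReal * ‖p‖ ^ 2 := by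
    filter_upwards [eventually_lt_of_limsup_lt ht1,
      (tendsto_norm_cocompact_atTop (E := Plane)).eventually_gt_atTop 0] with p hp hp0
    have h2 : ‖A p‖ / ‖p‖ ^ 2 ≤ t.toReal := (ENNReal.ofReal_le_iff_le_toReal htop).mp hp.le
    rwa [div_le_iff₀ (by positivity)] at h2
  obtain ⟨K, hK, hKev⟩ := mem_cocompact.mp hev
  obtain ⟨C, hC⟩ := hK.exists_bound_of_continuousOn hA.continuousOn
  refine ⟨1 - s - t.toReal, max C 0, by linarith, le_max_right _ _, fun p => ?_⟩
  rw [sub_sub_cancel]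
  by_cases hp : p ∈ K
  · have h5 : 0 ≤ t.toReal * ‖p‖ ^ 2 := by positivity
    linarith [hC p hp, le_max_left C 0]
  · have h6 : ‖A p‖ ≤ t.toReal * ‖p‖ ^ 2 := hKev hp
    linarith [le_max_right C 0]

/-- The bounded symbol `Ĥ₀(2πξ) / (1 + |2πξ|²)`, which represents the form of `H₀` in the coordinate
of the Sobolev space. -/
noncomputable def formSymbol (A : Plane → ℂ) (ξ : Plane) : Spin →L[ℂ] Spin :=
  (((1 + momentumSq ξ)⁻¹ : ℝ) : ℂ) • symbolCLM A ξ

lemma formSymbol_apply (ξ : Plane) (v : Spin) :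
    formSymbol A ξ v = (((1 + momentumSq ξ)⁻¹ : ℝ) : ℂ) • symbolCLM A ξ v := rfl

lemma isMultiplier_formSymbol (hA : Continuous A)
    (hgrow : ∃ C, ∀ p, ‖A p‖ ≤ ‖p‖ ^ 2 + C) : IsMultiplier volume (formSymbol A) := by
  constructor
  · refine Continuous.aestronglyMeasurable ?_
    exact (Complex.continuous_ofReal.comp continuous_inv_one_add_momentumSq).smul
      (continuous_symbolCLM hA)
  · obtain ⟨C, hC⟩ := hgrow
    refine ⟨2 + |C|, fun ξ => ContinuousLinearMap.opNorm_le_bound _ (by positivity) fun v => ?_⟩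
    have h0 := momentumSq_nonneg ξ
    have h1 := hC ((2 * Real.pi) • ξ)
    rw [norm_smul_sq_eq_momentumSq] at h1
    rw [formSymbol_apply, norm_smul, Complex.norm_real, Real.norm_of_nonneg (by positivity),
      inv_mul_le_iff₀ (by positivity), ← mul_assoc]
    refine (norm_symbolCLM_apply_le ξ v).trans (mul_le_mul_of_nonneg_right ?_ (norm_nonneg _))
    nlinarith [le_abs_self C, mul_nonneg h0 (abs_nonneg C)]

/-- The operator representing the form of `H₀` in the coordinate of the Sobolev space. -/
noncomputable def rep0 (hA : Continuous A) (hgrow : ∃ C, ∀ p, ‖A p‖ ≤ ‖p‖ ^ 2 + C) :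
    Spinors →L[ℂ] Spinors :=
  mulOp (isMultiplier_formSymbol hA hgrow)

variable (hA : Continuous A) (hgrow : ∃ C, ∀ p, ‖A p‖ ≤ ‖p‖ ^ 2 + C)

lemma isSelfAdjoint_rep0 : IsSelfAdjoint (rep0 hA hgrow) := by
  refine isSelfAdjoint_mulOp _ fun ξ v w => ?_
  rw [formSymbol_apply, formSymbol_apply, inner_smul_left, inner_smul_right, Complex.conj_ofReal,
    inner_symbolCLM_comm]

lemma formH0_sobolevEquiv (f g : Spinors) :
    formH0 A (sobolevEquiv f) (sobolevEquiv g) = inner ℂ f (rep0 hA hgrow g) := by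
  rw [formH0, rep0, inner_mulOp, coe_sobolevEquiv, coe_sobolevEquiv]
  refine integral_congr_ae ?_
  filter_upwards [divWeight_coeFn f, divWeight_coeFn g] with ξ hf hg
  rw [symbolFourier_eq, fourier_sobolevCoord, fourier_sobolevCoord, hf, hg, formSymbol_apply,
    map_smul, inner_smul_left, inner_smul_right, inner_smul_right, Complex.conj_ofReal,
    ← weight_inv_sq]
  push_cast
  ring

/-- Ellipticity of `Ĥ₀`, with room for half of a form-bounded perturbation. -/
lemma le_re_inner_rep0 {a b c C r : ℝ}
    (hG : ∀ p, ‖A p‖ ≤ (1 - a / 2 - c) * ‖p‖ ^ 2 + C) (hr : c + b / 2 + C ≤ r) (f : Spinors) :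
    c * ‖f‖ ^ 2 + (∫ ξ, boundRatio a b ξ * ‖f ξ‖ ^ 2) / 2 ≤
      (inner ℂ f (rep0 hA hgrow f)).re + r * ‖sobolevCoord f‖ ^ 2 := by
  have hN := isMultiplier_formSymbol hA hgrow
  have i1 := integrable_norm_sq f
  have i2 := integrable_mul_norm_sq (isMultiplier_boundRatio a b) f
  have i3 : Integrable fun ξ => (inner ℂ (f ξ) (formSymbol A ξ (f ξ))).re :=
    (integrable_inner_mulOp hN f f).re
  have i4 : Integrable fun ξ => (1 + momentumSq ξ)⁻¹ * ‖f ξ‖ ^ 2 := by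
    refine integrable_mul_norm_sq (isMultiplier_scalarSymbol
      continuous_inv_one_add_momentumSq.measurable ⟨1, fun ξ => ?_⟩) f
    rw [abs_of_nonneg (inv_nonneg.mpr (by linarith [momentumSq_nonneg ξ]))]
    exact inv_le_one_of_one_le₀ (by linarith [momentumSq_nonneg ξ])
  have e3 : (inner ℂ f (rep0 hA hgrow f)).re = ∫ ξ, (inner ℂ (f ξ) (formSymbol A ξ (f ξ))).re := by
    rw [rep0, inner_mulOp]
    exact (integral_re (integrable_inner_mulOp hN f f)).symm
  rw [norm_sq_eq_integral, norm_sobolevCoord_sq, e3, ← integral_const_mul, ← integral_const_mul,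
    ← integral_div, ← integral_add (i1.const_mul c) (i2.div_const 2),
    ← integral_add i3 (i4.const_mul r)]
  refine integral_mono ((i1.const_mul c).add (i2.div_const 2)) (i3.add (i4.const_mul r))
    fun ξ => ?_
  have h0 := momentumSq_nonneg ξ
  have h1 := hG ((2 * Real.pi) • ξ)
  rw [norm_smul_sq_eq_momentumSq] at h1
  have h2 := le_re_inner_symbolCLM (A := A) ξ (f ξ)
  change c * ‖f ξ‖ ^ 2 + boundRatio a b ξ * ‖f ξ‖ ^ 2 / 2 ≤
    (inner ℂ (f ξ) (formSymbol A ξ (f ξ))).re + r * ((1 + momentumSq ξ)⁻¹ * ‖f ξ‖ ^ 2)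
  rw [formSymbol_apply, inner_smul_right, Complex.re_ofReal_mul, boundRatio]
  have h3 : c * ‖f ξ‖ ^ 2 = (1 + momentumSq ξ)⁻¹ * (c * (1 + momentumSq ξ) * ‖f ξ‖ ^ 2) := by
    field_simp
  have h4 : c * (1 + momentumSq ξ) * ‖f ξ‖ ^ 2 + (a * momentumSq ξ + b) / 2 * ‖f ξ‖ ^ 2 ≤
      (inner ℂ (f ξ) (symbolCLM A ξ (f ξ))).re + r * ‖f ξ‖ ^ 2 := by
    nlinarith [sq_nonneg ‖f ξ‖]
  have h5 := mul_le_mul_of_nonneg_left h4 (inv_nonneg.mpr (by linarith : 0 ≤ 1 + momentumSq ξ))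
  rw [h3]
  linarith

/-- The operator `H₀`, defined by multiplication on its maximal domain, is the operator associated
with its form on the Sobolev space. -/
lemma isFormOperator_H0 (hA : Continuous A) {c C : ℝ} (hc : 0 < c)
    (hG : ∀ p, ‖A p‖ ≤ (1 - c) * ‖p‖ ^ 2 + C) :
    IsFormOperator sobolev (formH0 A) (H0 A) := by
  intro u w
  constructor
  · intro hmem
    obtain ⟨⟨u', hu'⟩, h1, h2⟩ := (LinearPMap.mem_graph_iff _).mp hmem
    obtain rfl : u' = u := h1
    have hS : MemLp (symbolFourier A u') 2 volume := hu'
    have hw : (𝓕 w : Spinors) = hS.toLp _ := by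
      have h2' : (𝓕⁻ (hS.toLp _ : Spinors) : Spinors) = w := h2
      rw [← h2', FourierTransform.fourier_fourierInv_eq]
    have hu : u' ∈ sobolev := by
      -- `c (1 + |p|²) |û| ≤ |Ĥ₀ û| + (c + |C|) |û|` bounds even the `H²` weight
      have hdom : MemLp (fun ξ => ‖symbolFourier A u' ξ‖ + (c + |C|) * ‖(𝓕 u' : Spinors) ξ‖) 2
          volume := hS.norm.add ((Lp.memLp (𝓕 u' : Spinors)).norm.const_mul _)
      refine hdom.of_le_mul (c := c⁻¹) ?_ (Eventually.of_forall fun ξ => ?_)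
      · exact continuous_weight.aestronglyMeasurable.smul
          (Lp.aestronglyMeasurable (𝓕 u' : Spinors))
      set v := (𝓕 u' : Spinors) ξ with hv
      have h0 := momentumSq_nonneg ξ
      have h3 := hG ((2 * Real.pi) • ξ)
      rw [norm_smul_sq_eq_momentumSq] at h3
      have h4 := le_re_inner_symbolCLM (A := A) ξ v
      have h5 : (inner ℂ v (symbolCLM A ξ v)).re ≤ ‖v‖ * ‖symbolCLM A ξ v‖ :=
        (Complex.re_le_norm _).trans (norm_inner_le_norm _ _)
      have h6 : c * (1 + momentumSq ξ) * ‖v‖ ≤ ‖symbolCLM A ξ v‖ + (c + |C|) * ‖v‖ := by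
        rcases (norm_nonneg v).eq_or_lt with hv0 | hv0
        · rw [← hv0]
          simp
        · refine le_of_mul_le_mul_left ?_ hv0
          have h7 : (c * momentumSq ξ - |C|) * ‖v‖ ^ 2 ≤
              (momentumSq ξ - ‖A ((2 * Real.pi) • ξ)‖) * ‖v‖ ^ 2 :=
            mul_le_mul_of_nonneg_right (by linarith [le_abs_self C]) (sq_nonneg _)
          linarith
      have h8 : weight ξ ≤ 1 + momentumSq ξ := by
        rw [← weight_sq]
        nlinarith [one_le_weight ξ]
      rw [weightedFourier_eq, symbolFourier_eq, ← hv, norm_smul,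
        Real.norm_of_nonneg (weight_pos ξ).le, Real.norm_of_nonneg (by positivity),
        inv_mul_eq_div, le_div_iff₀ hc]
      have h9 := mul_le_mul_of_nonneg_right h8 (mul_nonneg hc.le (norm_nonneg v))
      linarith
    refine ⟨hu, fun v => ?_⟩
    rw [← Lp.inner_fourier_eq, hw, L2.inner_def, formH0]
    refine integral_congr_ae ?_
    filter_upwards [hS.coeFn_toLp] with ξ hξ
    rw [hξ]
  · rintro ⟨hu, hform⟩
    obtain ⟨C', hC'⟩ : ∃ C', ∀ p, ‖A p‖ ≤ ‖p‖ ^ 2 + C' := ⟨C, fun p => (hG p).trans (by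
      nlinarith [mul_nonneg hc.le (sq_nonneg ‖p‖)])⟩
    obtain ⟨g, hg⟩ := sobolevEquiv.surjective ⟨u, hu⟩
    have hgu : sobolevCoord g = u := by rw [← coe_sobolevEquiv, hg]
    have hgrow' : ∃ C', ∀ p, ‖A p‖ ≤ ‖p‖ ^ 2 + C' := ⟨C', hC'⟩
    have hrep : rep0 hA hgrow' g = divWeight (𝓕 w) := by
      refine ext_inner_left ℂ fun f => ?_
      rw [← formH0_sobolevEquiv, hg, hform, coe_sobolevEquiv, inner_sobolevCoord]
    have hae : symbolFourier A u =ᵐ[volume] (𝓕 w : Spinors) := by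
      have h1 := mulOp_coeFn (isMultiplier_formSymbol hA hgrow') g
      have h2 : mulOp (isMultiplier_formSymbol hA hgrow') g = divWeight (𝓕 w) := hrep
      rw [h2] at h1
      filter_upwards [h1, divWeight_coeFn g, divWeight_coeFn (𝓕 w)] with ξ e1 e2 e3
      rw [e3, formSymbol_apply, ← weight_inv_sq, sq, Complex.ofReal_mul, ← smul_smul] at e1
      have hne : (((weight ξ)⁻¹ : ℝ) : ℂ) ≠ 0 := by
        exact_mod_cast inv_ne_zero (weight_pos ξ).ne'
      have e4 := smul_right_injective Spin hne e1
      rw [symbolFourier_eq, ← hgu, fourier_sobolevCoord, e2, map_smul, ← e4]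
    have hmem : u ∈ domH0 A := (Lp.memLp (𝓕 w : Spinors)).ae_eq hae.symm
    rw [LinearPMap.mem_graph_iff]
    refine ⟨⟨u, hmem⟩, rfl, ?_⟩
    change (𝓕⁻ ((domH0_memLp ⟨u, hmem⟩).toLp _ : Spinors) : Spinors) = w
    have h3 : ((domH0_memLp ⟨u, hmem⟩).toLp _ : Spinors) = 𝓕 w :=
      Lp.ext ((MemLp.coeFn_toLp _).trans hae)
    rw [h3, FourierTransform.fourierInv_fourier_eq]

/-- In the Fourier picture the shifted form of `H₀` is represented by a multiplication operator, so
its inverse commutes with the division by the weight. -/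
lemma inverse_shiftedRep_divWeight {r : ℝ}
    (hB : IsUnit (shiftedRep sobolevCoord (rep0 hA hgrow) r)) (f : Spinors) :
    Ring.inverse (shiftedRep sobolevCoord (rep0 hA hgrow) r) (divWeight f) =
      divWeight (Ring.inverse (shiftedRep sobolevCoord (rep0 hA hgrow) r) f) := by
  set B := shiftedRep sobolevCoord (rep0 hA hgrow) r with hBdef
  have hcomm : ∀ g, B (divWeight g) = divWeight (B g) := by
    intro g
    have h1 : rep0 hA hgrow (divWeight g) = divWeight (rep0 hA hgrow g) :=
      mulOp_comm _ _ (fun ξ v => by rw [scalarSymbol_apply, scalarSymbol_apply, map_smul]) g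
    have h2 : ∀ g, ContinuousLinearMap.adjoint sobolevCoord (sobolevCoord g) =
        divWeight (divWeight g) := fun g => by
      rw [adjoint_sobolevCoord, fourier_sobolevCoord]
    have h3 : ∀ g, B g = rep0 hA hgrow g + (r : ℂ) • divWeight (divWeight g) := fun g => by
      rw [hBdef, shiftedRep_apply, h2]
    rw [h3, h3, h1, divWeight.map_add, divWeight.map_smul]
  have hinv1 : ∀ g, Ring.inverse B (B g) = g := fun g =>
    congrArg (fun T : Spinors →L[ℂ] Spinors => T g) (Ring.inverse_mul_cancel B hB)
  have hinv2 : ∀ g, B (Ring.inverse B g) = g := fun g =>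
    congrArg (fun T : Spinors →L[ℂ] Spinors => T g) (Ring.mul_inverse_cancel B hB)
  conv_lhs => rw [← hinv2 f, ← hcomm, hinv1]

end Symbol

/-! ### The perturbation by the measure -/

section Perturbation

open ContinuousLinearMap (adjoint)

variable {A : Plane → ℂ} {m : Measure Plane} [IsFiniteMeasure m] {h : Plane → ℝ} {a b : ℝ}

/-- The operator representing the form of `ν = h m` in the coordinate of the Sobolev space. -/
noncomputable def repNu (m : Measure Plane) [IsFiniteMeasure m]
    (hh : IsMultiplier m (scalarSymbol h)) : Spinors →L[ℂ] Spinors :=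
  pullback (traceCoord m) (mulOp hh)

lemma isSelfAdjoint_repNu (hh : IsMultiplier m (scalarSymbol h)) :
    IsSelfAdjoint (repNu m hh) :=
  isSelfAdjoint_pullback _ (isSelfAdjoint_mulOp hh (inner_scalarSymbol_comm h))

lemma inner_repNu (hh : IsMultiplier m (scalarSymbol h)) (f g : Spinors) :
    inner ℂ f (repNu m hh g) = inner ℂ (traceCoord m f) (mulOp hh (traceCoord m g)) :=
  inner_pullback _ _ _ _

lemma formNu_sobolevEquiv (hh : IsMultiplier m (scalarSymbol h)) (f g : Spinors) :
    formNu m h (sobolevEquiv f) (sobolevEquiv g) = inner ℂ f (repNu m hh g) := by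
  rw [inner_repNu, inner_mulOp]
  refine integral_congr_ae (Eventually.of_forall fun x => ?_)
  dsimp only
  rw [← traceCoord_apply, ← traceCoord_apply, scalarSymbol_apply, inner_smul_right]

/-- Since `2|h| ≤ 1 + h²`, the form of `ν` is bounded by half the right-hand side of the form
bound. -/
lemma FormBound.le_re_inner_repNu (hab : FormBound m h a b) (hmeas : Measurable h)
    (hbdd : ∃ C : ℝ, ∀ x, |h x| ≤ C) (hh : IsMultiplier m (scalarSymbol h)) (f : Spinors) :
    -((∫ ξ, boundRatio a b ξ * ‖f ξ‖ ^ 2) / 2) ≤ (inner ℂ f (repNu m hh f)).re := by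
  have h1 := hab.integral_traceCoord_le hmeas hbdd f
  have i1 := integrable_mul_norm_sq hh (traceCoord m f)
  have i2 := integrable_mul_norm_sq (isMultiplier_one_add_sq (m := m) hmeas hbdd) (traceCoord m f)
  rw [inner_repNu, inner_mulOp_scalarSymbol, Complex.ofReal_re]
  have h2 : ∫ x, -((1 + h x ^ 2) * ‖traceCoord m f x‖ ^ 2 / 2) ∂m ≤
      ∫ x, h x * ‖traceCoord m f x‖ ^ 2 ∂m := by
    refine integral_mono (i2.div_const 2).neg i1 fun x => ?_
    nlinarith [mul_nonneg (sq_nonneg (1 + h x)) (sq_nonneg ‖traceCoord m f x‖)]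
  rw [integral_neg, integral_div] at h2
  linarith

/-- The perturbation enters the resolvent difference through the trace of the resolvent of `H₀`,
which factors through the compact trace map of `H²`. -/
lemma FormBound.isCompactOperator_resolvent_sub (hab : FormBound m h a b) (hmeas : Measurable h)
    (hbdd : ∃ C : ℝ, ∀ x, |h x| ≤ C) (hh : IsMultiplier m (scalarSymbol h))
    (hA : Continuous A) (hgrow : ∃ C, ∀ p, ‖A p‖ ≤ ‖p‖ ^ 2 + C) {r : ℝ}
    (hB₀ : IsUnit (shiftedRep sobolevCoord (rep0 hA hgrow) r))
    (hB : IsUnit (shiftedRep sobolevCoord (rep0 hA hgrow + repNu m hh) r)) :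
    IsCompactOperator
      (formResolvent sobolevCoord (shiftedRep sobolevCoord (rep0 hA hgrow) r) -
        formResolvent sobolevCoord (shiftedRep sobolevCoord (rep0 hA hgrow + repNu m hh) r)) := by
  refine isCompactOperator_formResolvent_sub hB₀ hB ?_
  have hswap := inverse_shiftedRep_divWeight hA hgrow hB₀
  generalize Ring.inverse (shiftedRep sobolevCoord (rep0 hA hgrow) r) = C₀ at *
  have hK := (hab.isCompactOperator_trace_divWeight hmeas hbdd).comp_clm
    (C₀ ∘L (Lp.fourierTransformₗᵢ Plane Spin).toContinuousLinearEquiv.toContinuousLinearMap)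
  refine (congrArg IsCompactOperator (funext fun v => ?_)).mpr hK
  change traceCoord m (C₀ (adjoint sobolevCoord v)) = traceCoord m (divWeight (C₀ (𝓕 v)))
  rw [adjoint_sobolevCoord, hswap]

end Perturbation

end SpinOrbit

theorem theorem1
    (A : SpinOrbit.Plane → ℂ) (hA : Continuous A) (hlim : SpinOrbit.limsupRatio A < 1)
    (m : MeasureTheory.Measure SpinOrbit.Plane) [MeasureTheory.IsFiniteMeasure m]
    (h : SpinOrbit.Plane → ℝ) (hmeas : Measurable h) (hbdd : ∃ C : ℝ, ∀ x, |h x| ≤ C)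
    (a b : ℝ) (ha : 0 < a) (ha1 : a < 1) (hb : 0 < b) (hab : SpinOrbit.FormBound m h a b) :
    (SpinOrbit.limsupRatio A + ENNReal.ofReal (a / 2) < 1 →
      SpinOrbit.FormSemibounded SpinOrbit.sobolev (SpinOrbit.formH A m h) ∧
        SpinOrbit.FormClosed SpinOrbit.sobolev (SpinOrbit.formH A m h)) ∧
    (SpinOrbit.FormSemibounded SpinOrbit.sobolev (SpinOrbit.formH A m h) →
      SpinOrbit.FormClosed SpinOrbit.sobolev (SpinOrbit.formH A m h) →
      ∃ H : SpinOrbit.Spinors →ₗ.[ℂ] SpinOrbit.Spinors,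
        SpinOrbit.IsFormOperator SpinOrbit.sobolev (SpinOrbit.formH A m h) H ∧
        IsSelfAdjoint H ∧
        SpinOrbit.essentialSpectrum H =
          SpinOrbit.essentialSpectrum (SpinOrbit.H0 A)) := by
  open SpinOrbit in
  obtain ⟨c, C, hc, hC, hG⟩ := exists_norm_le_of_limsupRatio hA le_rfl (by simpa using hlim)
  rw [sub_zero] at hG
  have hgrow : ∃ C, ∀ p, ‖A p‖ ≤ ‖p‖ ^ 2 + C := ⟨C, fun p => (hG p).trans (by
    nlinarith [mul_nonneg hc.le (sq_nonneg ‖p‖)])⟩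
  have hh : IsMultiplier m (scalarSymbol h) := isMultiplier_scalarSymbol hmeas hbdd
  have hq₀ := formH0_sobolevEquiv hA hgrow
  have hq : ∀ f g, formH A m h (sobolevEquiv f) (sobolevEquiv g) =
      inner ℂ f ((rep0 hA hgrow + repNu m hh) g) := fun f g => by
    rw [formH, hq₀, formNu_sobolevEquiv hh, add_apply, inner_add_right]
  have hN₀ := isSelfAdjoint_rep0 hA hgrow
  have hN : IsSelfAdjoint (rep0 hA hgrow + repNu m hh) := hN₀.add (isSelfAdjoint_repNu hh)
  refine ⟨fun hθ => ?_, fun hsemi hclosed => ?_⟩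
  · obtain ⟨c', C', hc', -, hG'⟩ := exists_norm_le_of_limsupRatio hA (by positivity) hθ
    refine semibounded_and_closed_of_coercive coe_sobolevEquiv hq (r := c' + b / 2 + C')
      ⟨c', hc', fun f => ?_⟩
    have h1 := le_re_inner_rep0 hA hgrow (b := b) hG' le_rfl f
    have h2 := hab.le_re_inner_repNu hmeas hbdd hh f
    rw [re_inner_shiftedRep, add_apply, inner_add_right, Complex.add_re]
    linarith
  · obtain ⟨r₁, hr₁⟩ := exists_forall_coercive coe_sobolevEquiv sobolevCoord_injective hq hN
      hsemi hclosed
    -- one shift for which both `H` and `H₀` are coercive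
    set r := max r₁ (c + C) with hr
    have hB := hr₁ r (le_max_left _ _)
    have hB₀ : Coercive (shiftedRep sobolevCoord (rep0 hA hgrow) r) := by
      refine ⟨c, hc, fun f => ?_⟩
      have h1 := le_re_inner_rep0 hA hgrow (a := 0) (b := 0) (c := c) (C := C) (r := r)
        (by simpa using hG) (by rw [zero_div, add_zero]; exact le_max_right r₁ (c + C)) f
      rw [re_inner_shiftedRep]
      simpa [boundRatio] using h1
    have hR := isSelfAdjoint_formResolvent (Λ := sobolevCoord)
      (isSelfAdjoint_shiftedRep sobolevCoord hN r)
    have hR₀ := isSelfAdjoint_formResolvent (Λ := sobolevCoord)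
      (isSelfAdjoint_shiftedRep sobolevCoord hN₀ r)
    obtain ⟨H, hH, hHsa⟩ := exists_isSelfAdjoint_isResolventAt hR
      (formResolvent_injective denseRange_sobolevCoord hB) r
    have hH₀ := (isFormOperator_iff_isResolventAt coe_sobolevEquiv hq₀ hB₀.isUnit (H0 A)).mp
      (isFormOperator_H0 hA hc hG)
    refine ⟨H, (isFormOperator_iff_isResolventAt coe_sobolevEquiv hq hB.isUnit H).mpr hH, hHsa, ?_⟩
    exact (essentialSpectrum_eq_of_compact_sub hH₀ hH hR₀ hR
      (hab.isCompactOperator_resolvent_sub hmeas hbdd hh hA hgrow hB₀.isUnit hB.isUnit)).symm
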